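/- Let $d\ge 2$, $I=\{1,\dots,d\}$, and let $\Sigma_d=I^{\mathbb N}$ be the full shift with left shift $\sigma$, cylinders $[\omega]$ and Birkhoff sums $S_nf=\sum_{k=0}^{n-1}f\circ\sigma^k$. A *conformal iterated function system* (CS) $\Phi=(\phi_i:X\to\operatorname{Int}X\mid i\in I)$ consists of injective contractions of a non-empty compact connected set $X\subset\mathbb R$ such that the sets $\phi_i(\operatorname{Int}X)$, $i\in I$, are pairwise disjoint and such that, for some open connected $U\subset\mathbb C$ with $X\subset U$, every $\phi_i$ extends to a conformal map $U\to U$ (holomorphic with nowhere vanishing derivative), with bounded distortion: there is $C\ge1$ with $|\phi_\omega'(y)|\le C|\phi_\omega'(x)|$ for all finite words $\omega$ and all $x,y\in U$, where $\phi_\omega=\phi_{x_1}\circ\cdots\circ\phi_{x_n}$ for $\omega=x_1\cdots x_n$. Its limit set is $\Lambda(\Phi)=\bigcap_n\bigcup_{\omega\in I^n}\phi_\omega(X)$, and $\pi_\Phi:\Sigma_d\to\Lambda(\Phi)$ is given by $\{\pi_\Phi(x)\}=\bigcap_n\phi_{x_1\cdots x_n}(X)$. The system is *affine* if every $\phi_i$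 is affine. A CS $\Psi$ is *essentially affine* if there are an affine CS $\Phi$ (with the same $I$) and a bi-Lipschitz bijection $h:\Lambda(\Phi)\to\Lambda(\Psi)$ with $\psi_i=h\circ\phi_i\circ h^{-1}$ on $\Lambda(\Psi)$ for all $i\in I$. For a CS $\Phi$ and $u\in\mathbb R$ put: * $I_\Phi(x)=\log|\phi_{x_1}'(\pi_\Phi(\sigma x))|$ for $x=(x_1x_2\dots)\in\Sigma_d$; * $P_\Phi(u)=\lim_{n\to\infty}\frac1n\log\sum_{\omega\in I^n}\exp\bigl(\sup_{x\in[\omega]}S_n(uI_\Phi)(x)\bigr)$ and $\alpha_\Phi(u)=-P_\Phi'(u)$; * $\mu_{\Phi,u}$ is the $\sigma$-invariant Gibbs probability measure on $\Sigma_d$ for $uI_\Phi-P_\Phi(u)$, that is, $\mu_{\Phi,u}([x_1\cdots x_n])\asymp e^{uS_nI_\Phi(x)-nP_\Phi(u)}$ with constants independent of $n$ and $x$; * $\ell_\Phi(\alpha)=\dim_H\pi_\Phi\bigl(\{x\in\Sigma_d:\lim_{n\to\infty}S_nI_\Phi(x)/(-n)=\alpha\}\bigr)$ for $\alpha\in\mathbb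 R$. Write $\mu_{\Phi,u}\cong\mu_{\Psi,v}$ if $\mu_{\Phi,u}=\mu_{\Psi_0,v}$ for some system $\Psi_0$ obtained from $\Psi$ by a permutation of its generators. For $a,c\in\mathbb R$ write $I_\Phi\simeq aI_\Psi+c$ if, for some such $\Psi_0$, there is a continuous $e:\Sigma_d\to\mathbb R$ with $I_\Phi-(aI_{\Psi_0}+c)=e-e\circ\sigma$. **Theorem (Multifractal flexibility for essentially affine systems).** Let $\Phi,\Psi$ be essentially affine conformal iterated function systems, each with $d$ generators, and let $u,v\in\mathbb R\setminus\{0\}$. Then the following three statements are equivalent: (i) $\mu_{\Phi,u}\cong\mu_{\Psi,v}$; (ii) $\displaystyle I_\Phi\simeq\frac vu I_\Psi+\frac{P_\Phi(u)-P_\Psi(v)}u$; (iii) $\displaystyle P_\Phi(s)=P_\Psi\Bigl(s\cdot\frac vu\Bigr)+s\cdot\frac{P_\Phi(u)-P_\Psi(v)}u$ for all $s\in\mathbb R$. Furthermore, each of the statements (i)–(iii) implies (iv) $\alpha_\Phi(u)\,\ell_\Phi(\alpha_\Phi(u))=\alpha_\Psi(v)\,\ell_\Psi(\alpha_\Psi(v))$.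 -/

import Mathlib

open Set Filter Topology MeasureTheory
open scoped NNReal

noncomputable section

namespace ConfIFS

/-! ### The full shift -/

/-- The full shift space `Σ_d = I^ℕ` with `I = Fin d` (product topology and product
σ-algebra). -/
abbrev FullShift (d : ℕ) : Type := ℕ → Fin d

/-- The left shift `σ`. -/
def shift {d : ℕ} (x : FullShift d) : FullShift d := fun n => x (n + 1)

/-- The cylinder `[ω]` of a finite word `ω`. -/
def cylinder {d n : ℕ} (ω : Fin n → Fin d) : Set (FullShift d) :=
  {y | ∀ k : Fin n, y k = ω k}

/-- The initial word `x₁ … x_n` of a sequence. -/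
def initWord {d : ℕ} (x : FullShift d) (n : ℕ) : Fin n → Fin d := fun k => x k

/-- `φ_ω = φ_{x₁} ∘ ⋯ ∘ φ_{x_n}` for `ω = x₁ … x_n`. -/
def wordMap {d : ℕ} {α : Type*} (f : Fin d → α → α) : List (Fin d) → α → α
  | [] => id
  | i :: ω => f i ∘ wordMap f ω

/-! ### Conformal iterated function systems -/

/-- A conformal iterated function system with `d` generators on a connected compact set
`X ⊆ ℝ`. Only the values of the generators on `X` are relevant. -/
structure ConformalIFS (d : ℕ) where
  X : Set ℝ
  isCompact_X : IsCompact X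
  isConnected_X : IsConnected X
  map : Fin d → ℝ → ℝ
  mapsTo : ∀ i, MapsTo (map i) X (interior X)
  injOn : ∀ i, InjOn (map i) X
  contraction : ∃ c : ℝ≥0, c < 1 ∧ ∀ i, LipschitzOnWith c (map i) X
  /-- Open set condition (its first half is part of `mapsTo`). -/
  openSet : ∀ i j, i ≠ j → Disjoint (map i '' interior X) (map j '' interior X)
  /-- Conformality and bounded distortion: the generators extend to conformal (that is,
  holomorphic with nowhere vanishing derivative) self-maps of an open connected `U ⊆ ℂ`
  containing `X`, and the derivatives of all their compositions have distortion on `U`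
  bounded by a common constant. -/
  conformal : ∃ (U : Set ℂ) (ext : Fin d → ℂ → ℂ),
    IsOpen U ∧ IsConnected U ∧ (∀ x ∈ X, (x : ℂ) ∈ U) ∧
    (∀ i, MapsTo (ext i) U U) ∧
    (∀ i, DifferentiableOn ℂ (ext i) U) ∧
    (∀ i, ∀ z ∈ U, deriv (ext i) z ≠ 0) ∧
    (∀ i, ∀ x ∈ X, ext i (x : ℂ) = ((map i x : ℝ) : ℂ)) ∧
    ∃ C : ℝ, 1 ≤ C ∧ ∀ ω : List (Fin d), ∀ x ∈ U, ∀ y ∈ U,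
      ‖deriv (wordMap ext ω) y‖ ≤ C * ‖deriv (wordMap ext ω) x‖

theorem wordMap_comp {d : ℕ} {α : Type*} (f : Fin d → α → α) (τ : Fin d → Fin d)
    (ω : List (Fin d)) : wordMap (fun i => f (τ i)) ω = wordMap f (ω.map τ) := by
  induction ω with
  | nil => rfl
  | cons i ω ih => simp [wordMap, ih]

theorem wordMap_append {d : ℕ} {α : Type*} (f : Fin d → α → α) (ω η : List (Fin d)) :
    wordMap f (ω ++ η) = wordMap f ω ∘ wordMap f η := by
  induction ω with
  | nil => rfl
  | cons i ω ih => simp [wordMap, ih, Function.comp_assoc]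

namespace ConformalIFS

variable {d : ℕ}

/-- The system obtained from `Φ` by permuting its generators. -/
def perm (Φ : ConformalIFS d) (τ : Equiv.Perm (Fin d)) : ConformalIFS d where
  X := Φ.X
  isCompact_X := Φ.isCompact_X
  isConnected_X := Φ.isConnected_X
  map := fun i => Φ.map (τ i)
  mapsTo := fun i => Φ.mapsTo (τ i)
  injOn := fun i => Φ.injOn (τ i)
  contraction := by
    obtain ⟨c, hc, h⟩ := Φ.contraction
    exact ⟨c, hc, fun i => h (τ i)⟩
  openSet := fun i j hij => Φ.openSet _ _ (fun h => hij (τ.injective h))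
  conformal := by
    obtain ⟨U, ext, h1, h2, h3, h4, h5, h6, h7, C, hC, h8⟩ := Φ.conformal
    refine ⟨U, fun i => ext (τ i), h1, h2, h3, fun i => h4 _, fun i => h5 _, fun i => h6 _,
      fun i => h7 _, C, hC, fun ω x hx y hy => ?_⟩
    rw [wordMap_comp ext τ ω]
    exact h8 _ x hx y hy

/-- The limit set `Λ(Φ) = ⋂_n ⋃_{ω ∈ Iⁿ} φ_ω(X)`. -/
def limitSet (Φ : ConformalIFS d) : Set ℝ :=
  ⋂ n : ℕ, ⋃ ω : Fin n → Fin d, wordMap Φ.map (List.ofFn ω) '' Φ.X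

theorem mapsTo_wordMap (Φ : ConformalIFS d) (ω : List (Fin d)) :
    MapsTo (wordMap Φ.map ω) Φ.X Φ.X := by
  induction ω with
  | nil => exact mapsTo_id _
  | cons i ω ih => exact ((Φ.mapsTo i).mono_right interior_subset).comp ih

theorem lipschitz_wordMap (Φ : ConformalIFS d) {c : ℝ≥0}
    (hc : ∀ i, LipschitzOnWith c (Φ.map i) Φ.X) (ω : List (Fin d)) :
    LipschitzOnWith (c ^ ω.length) (wordMap Φ.map ω) Φ.X := by
  induction ω with
  | nil => simpa [wordMap] using (LipschitzWith.id.lipschitzOnWith (s := Φ.X))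
  | cons i ω ih =>
    have := (hc i).comp ih (Φ.mapsTo_wordMap ω)
    simpa [wordMap, pow_succ'] using this

/-- The sets `φ_{x₁ … x_n}(X)` shrink to exactly one point. -/
theorem existsUnique_coding (Φ : ConformalIFS d) (x : FullShift d) :
    ∃! p : ℝ, ∀ n : ℕ, p ∈ wordMap Φ.map (List.ofFn (initWord x n)) '' Φ.X := by
  obtain ⟨c, hc1, hc⟩ := Φ.contraction
  have hcpt : ∀ n : ℕ, IsCompact (wordMap Φ.map (List.ofFn (initWord x n)) '' Φ.X) :=
    fun n => Φ.isCompact_X.image_of_continuousOn (Φ.lipschitz_wordMap hc _).continuousOn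
  have hex : (⋂ n : ℕ, wordMap Φ.map (List.ofFn (initWord x n)) '' Φ.X).Nonempty := by
    refine IsCompact.nonempty_iInter_of_sequence_nonempty_isCompact_isClosed _ (fun n => ?_)
      (fun n => Φ.isConnected_X.nonempty.image _) (hcpt 0) (fun n => (hcpt n).isClosed)
    have : List.ofFn (initWord x (n + 1)) = List.ofFn (initWord x n) ++ [x n] := by
      rw [List.ofFn_succ_last]; rfl
    rw [this, wordMap_append, image_comp]
    exact image_mono (Φ.mapsTo_wordMap [x n]).image_subset
  obtain ⟨p, hp⟩ := hex
  rw [mem_iInter] at hp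
  refine ⟨p, hp, fun q hq => ?_⟩
  have hb : ∀ n : ℕ, dist q p ≤ (c : ℝ) ^ n * Metric.diam Φ.X := fun n => by
    obtain ⟨a, ha, rfl⟩ := hq n
    obtain ⟨b, hb, hb'⟩ := hp n
    rw [← hb']
    have h1 := (Φ.lipschitz_wordMap hc (List.ofFn (initWord x n))).dist_le_mul a ha b hb
    rw [List.length_ofFn, NNReal.coe_pow] at h1
    exact h1.trans (mul_le_mul_of_nonneg_left
      (Metric.dist_le_diam_of_mem Φ.isCompact_X.isBounded ha hb) (by positivity))
  have hlim : Tendsto (fun n : ℕ => (c : ℝ) ^ n * Metric.diam Φ.X) atTop (𝓝 0) := by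
    simpa using (tendsto_pow_atTop_nhds_zero_of_lt_one c.coe_nonneg
      (by exact_mod_cast hc1)).mul_const (Metric.diam Φ.X)
  exact dist_le_zero.mp (ge_of_tendsto' hlim hb)

/-- The coding map `π_Φ : Σ_d → Λ(Φ)`: `π_Φ(x)` is the point to which the sets
`φ_{x₁ … x_n}(X)` shrink. -/
def codingMap (Φ : ConformalIFS d) (x : FullShift d) : ℝ :=
  (Φ.existsUnique_coding x).choose

/-- All generators are affine. -/
def IsAffine (Φ : ConformalIFS d) : Prop :=
  ∀ i, ∃ a b : ℝ, ∀ x ∈ Φ.X, Φ.map i x = a * x + b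

/-- `Ψ` is a deformation of `Φ`: some bi-Lipschitz bijection `h : Λ(Φ) → Λ(Ψ)` satisfies
`ψ_i = h ∘ φ_i ∘ h⁻¹` on `Λ(Ψ)` for all `i`. -/
def IsDeformation (Φ Ψ : ConformalIFS d) : Prop :=
  ∃ h : ℝ → ℝ, BijOn h Φ.limitSet Ψ.limitSet ∧
    (∃ K : ℝ, 0 < K ∧ ∀ x ∈ Φ.limitSet, ∀ y ∈ Φ.limitSet,
      K⁻¹ * |x - y| ≤ |h x - h y| ∧ |h x - h y| ≤ K * |x - y|) ∧
    ∀ i, ∀ x ∈ Φ.limitSet, Ψ.map i (h x) = h (Φ.map i x)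

/-- Essentially affine systems: deformations of affine systems. -/
def IsEssentiallyAffine (Ψ : ConformalIFS d) : Prop :=
  ∃ Φ : ConformalIFS d, Φ.IsAffine ∧ IsDeformation Φ Ψ

/-! ### Thermodynamic formalism -/

/-- The canonical geometric potential `I_Φ(x) = log |φ_{x₁}'(π_Φ(σ x))|`. The point
`π_Φ(σ x)` lies in the interior of `X`, so this is an honest derivative of the generator. -/
def geomPotential (Φ : ConformalIFS d) (x : FullShift d) : ℝ :=
  Real.log |deriv (Φ.map (x 0)) (Φ.codingMap (shift x))|

end ConformalIFS

/-- The pressure `𝒫(f) = lim_n (1/n) log ∑_{ω ∈ Iⁿ} exp (sup_{x ∈ [ω]} S_n f(x))`. -/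
def pressure {d : ℕ} (f : FullShift d → ℝ) : ℝ :=
  limUnder atTop (fun n : ℕ => (1 / (n : ℝ)) *
    Real.log (∑ ω : Fin n → Fin d,
      Real.exp (sSup ((fun x => birkhoffSum shift f n x) '' cylinder ω))))

/-- `μ` is a shift-invariant Gibbs (probability) measure for the (normalised) potential `f`:
`μ[x₁ … x_n] ≍ exp (S_n f(x))` uniformly in `n` and `x`. -/
def IsInvariantGibbs {d : ℕ} (f : FullShift d → ℝ) (μ : Measure (FullShift d)) : Prop :=
  IsProbabilityMeasure μ ∧ MeasurePreserving shift μ μ ∧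
    ∃ C : ℝ, 1 ≤ C ∧ ∀ (n : ℕ) (x : FullShift d),
      C⁻¹ * Real.exp (birkhoffSum shift f n x) ≤ μ.real (cylinder (initWord x n)) ∧
      μ.real (cylinder (initWord x n)) ≤ C * Real.exp (birkhoffSum shift f n x)

/-- `f` and `g` are cohomologous: `f - g = e - e ∘ σ` for some continuous `e`. -/
def Cohomologous {d : ℕ} (f g : FullShift d → ℝ) : Prop :=
  ∃ e : FullShift d → ℝ, Continuous e ∧ ∀ x, f x - g x = e x - e (shift x)

namespace ConformalIFS

variable {d : ℕ}

/-- The pressure function `P_Φ(u) = 𝒫(u I_Φ)`. -/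
def P (Φ : ConformalIFS d) (u : ℝ) : ℝ := pressure (fun x => u * Φ.geomPotential x)

/-- `α_Φ(u) = -P_Φ'(u)`. -/
def α (Φ : ConformalIFS d) (u : ℝ) : ℝ := -deriv Φ.P u

open Classical in
/-- `μ_{Φ,u}`: the (unique) shift-invariant Gibbs measure for `u I_Φ - P_Φ(u)`. -/
def gibbsMeasure (Φ : ConformalIFS d) (u : ℝ) : Measure (FullShift d) :=
  if h : ∃ μ, IsInvariantGibbs (fun x => u * Φ.geomPotential x - Φ.P u) μ then h.choose else 0

/-- The Lyapunov spectrum: `ℓ_Φ(a)` is the Hausdorff dimension of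
`π_Φ {x : lim_n S_n I_Φ(x) / (-n) = a}`. -/
def lyapunovSpectrum (Φ : ConformalIFS d) (a : ℝ) : ℝ :=
  (dimH (Φ.codingMap '' {x | Tendsto
    (fun n : ℕ => birkhoffSum shift Φ.geomPotential n x / (-(n : ℝ))) atTop (𝓝 a)})).toReal

/-- `μ_{Φ,u} ≅ μ_{Ψ,v}`: equality up to a permutation of the generators of `Ψ`. -/
def GibbsEqUpToPerm (Φ : ConformalIFS d) (u : ℝ) (Ψ : ConformalIFS d) (v : ℝ) : Prop :=
  ∃ τ : Equiv.Perm (Fin d), Φ.gibbsMeasure u = (Ψ.perm τ).gibbsMeasure v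

/-- `I_Φ ≃ a I_Ψ + c`: cohomological equivalence up to a permutation of the generators of
`Ψ`. -/
def CohomEqUpToPerm (Φ Ψ : ConformalIFS d) (a c : ℝ) : Prop :=
  ∃ τ : Equiv.Perm (Fin d),
    Cohomologous Φ.geomPotential (fun x => a * (Ψ.perm τ).geomPotential x + c)

end ConformalIFS

end ConfIFS

end

/-!
# Gibbs measures, pressure and Lyapunov spectra of essentially affine conformal systems

Let `Φ` be a deformation of an affine system with slopes `a_i`, and put `l_i = log |a_i| < 0`.
Everything about `Φ` that the theorem mentions is controlled by the numbers `l_i`.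

* The conjugacy to the affine model is bi-Lipschitz and intertwines the coding maps, so the distance
  of two points of the limit set whose codes split exactly at time `n` is comparable to
  `exp (l x₁ + ⋯ + l x_n)` (`HasLogRatios`, `HasLogRatios.of_isDeformation`). The lower bound uses
  strong separation, which holds because the generators map `X` into its interior.
* Around a periodic point, this metric information determines the multiplier of the return map, so
  that `I_Φ` and `x ↦ l x₁` have the same sums over periodic orbits
  (`HasLogRatios.birkhoffSum_eq_of_periodic`). Since `I_Φ` has exponentially decaying variations,
  Livsic's theorem (`exists_coboundary_of_periodic_sums_eq_zero`) makes the two potentials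
  cohomologous (`IsEssentiallyAffine.exists_hasLogRatios`).

Consequently `P_Φ(s) = log ∑ exp (s l_i)`, and `μ_{Φ,u}` is the Bernoulli measure with weights
`exp (u l_i - P_Φ(u))`; uniqueness of the invariant Gibbs measure comes from ergodicity of Bernoulli
measures. If `m_i` are the corresponding numbers for `Ψ`, the equality of Gibbs measures, the
cohomology of the potentials and the identity of pressure functions each say that
`l_i = (v / u) m_{τ i} + (P_Φ(u) - P_Ψ(v)) / u` for some permutation `τ`: compare the weights of the
Bernoulli measures (`gibbsMeasure_eq_iff`), evaluate at the fixed points of the shift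
(`cohomologous_geomPotential_iff`), and note that exponential sums determine their exponents up to
order (`P_eq_iff_exists_perm`).

The identity between the Lyapunov spectra needs no formula for the dimension. The affine relation
shows that the level sets for `α_Φ(u)` and `α_Ψ(v)` have, up to `τ`, the same codes. On these codes,
cylinders of length `n` have size `exp (-n α_Φ(u) + o(n))` for `Φ` and `exp (-n α_Ψ(v) + o(n))` for
`Ψ`, so the natural bijection between the two level sets is, up to a countable decomposition, Hölder
with every exponent below `α_Ψ(v) / α_Φ(u)`, and likewise for its inverse
(`mul_dimH_image_codingMap_eq`).
-/

noncomputable section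

namespace ConfIFS

/-! ### Symbolic dynamics and Livsic's theorem on the full shift -/

section Symbolic

variable {d : ℕ}

theorem shift_iterate_apply (n : ℕ) (x : FullShift d) (k : ℕ) : (shift^[n] x) k = x (k + n) := by
  induction n generalizing x with
  | zero => rfl
  | succ n ih => rw [Function.iterate_succ_apply, ih]; rfl

/-- The sequence with the first `n` entries of `w` followed by `x`. -/
def splice (n : ℕ) (w x : FullShift d) : FullShift d := fun k => if k < n then w k else x (k - n)

theorem splice_of_lt {n k : ℕ} (w x : FullShift d) (h : k < n) : splice n w x k = w k := if_pos h

theorem shift_iterate_splice (n : ℕ) (w x : FullShift d) : shift^[n] (splice n w x) = x := by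
  funext k
  simp [shift_iterate_apply, splice]

/-- The periodic sequence repeating the first `n` entries of `x`. -/
def periodize (n : ℕ) (x : FullShift d) : FullShift d := fun k => x (k % n)

theorem shift_iterate_periodize (n : ℕ) (x : FullShift d) :
    shift^[n] (periodize n x) = periodize n x := by
  funext k
  simp [shift_iterate_apply, periodize]

theorem periodize_of_lt {n k : ℕ} (x : FullShift d) (h : k < n) : periodize n x k = x k := by
  simp [periodize, Nat.mod_eq_of_lt h]

/-- Two sequences agreeing on their first `n + m` entries have Birkhoff sums of length `n` that
differ by `O(ρ ^ m)`, for a potential with exponentially decaying variations. -/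
theorem abs_birkhoffSum_sub_le {g : FullShift d → ℝ} {C ρ : ℝ} (hC : 0 ≤ C) (hρ0 : 0 ≤ ρ)
    (hρ1 : ρ < 1)
    (hg : ∀ n x y, (∀ k ≤ n, x k = y k) → |g x - g y| ≤ C * ρ ^ n) (m n : ℕ)
    (x y : FullShift d) (hxy : ∀ k < n + m, x k = y k) :
    |birkhoffSum shift g n x - birkhoffSum shift g n y| ≤ C / (1 - ρ) * ρ ^ m := by
  have h1 : 0 < 1 - ρ := by linarith
  -- The bound with the extra factor `1 - ρ ^ n` is the one that is stable under induction.
  have key : |birkhoffSum shift g n x - birkhoffSum shift g n y|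
      ≤ C / (1 - ρ) * ρ ^ m * (1 - ρ ^ n) := by
    induction n generalizing x y with
    | zero => simp
    | succ n ih =>
      rw [birkhoffSum_succ', birkhoffSum_succ']
      have a1 := hg (n + m) x y fun k hk => hxy k (by omega)
      have a2 := ih (shift x) (shift y) fun k hk => hxy (k + 1) (by omega)
      have a3 : C / (1 - ρ) * ρ ^ m * (1 - ρ ^ (n + 1))
          = C * ρ ^ (n + m) + C / (1 - ρ) * ρ ^ m * (1 - ρ ^ n) := by
        field_simp
        ring
      rw [a3, add_sub_add_comm]
      exact (abs_add_le _ _).trans (add_le_add a1 a2)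
  refine key.trans (mul_le_of_le_one_right (by positivity) ?_)
  have : 0 ≤ ρ ^ n := by positivity
  linarith

/-- **Livsic's theorem** on the full shift: a continuous potential with exponentially decaying
variations whose Birkhoff sums over all periodic orbits vanish is a coboundary. The transfer
function is the sum of `g` along the backward orbit `i^k x`, `k ≥ 1`, for one fixed letter `i`. -/
theorem exists_coboundary_of_periodic_sums_eq_zero (i : Fin d) {g : FullShift d → ℝ} {C ρ : ℝ}
    (hC : 0 ≤ C) (hρ0 : 0 ≤ ρ) (hρ1 : ρ < 1) (hcont : Continuous g)
    (hg : ∀ n x y, (∀ k ≤ n, x k = y k) → |g x - g y| ≤ C * ρ ^ n)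
    (hper : ∀ n x, 0 < n → shift^[n] x = x → birkhoffSum shift g n x = 0) :
    ∃ e : FullShift d → ℝ, Continuous e ∧ ∀ x, g x = e x - e (shift x) := by
  set c : FullShift d := fun _ => i with hc
  have hgc : g c = 0 := by simpa using hper 1 c one_pos rfl
  set T : ℕ → FullShift d → FullShift d := fun n x => splice n c x with hT
  have hTlt : ∀ n x k, k < n → T n x k = i := fun n x k h => splice_of_lt c x h
  have hTs : ∀ n x, shift^[n] (T n x) = x := fun n x => shift_iterate_splice n c x
  have hTss : ∀ n x, shift (T (n + 1) x) = T n x := fun n x => by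
    funext k
    simp [hT, hc, splice, shift]
  have hbound : ∀ n x, |g (T (n + 1) x)| ≤ C * ρ ^ n := fun n x => by
    have := hg n (T (n + 1) x) c fun k hk => hTlt _ _ _ (by omega)
    rwa [hgc, sub_zero] at this
  have hsummable : Summable fun n => C * ρ ^ n :=
    (summable_geometric_of_lt_one hρ0 hρ1).mul_left C
  have hTcont : ∀ n, Continuous (T n) := fun n => continuous_pi fun k => by
    by_cases h : k < n
    · simp only [hT, splice, h, if_true]; exact continuous_const
    · simp only [hT, splice, h, if_false]; exact continuous_apply _
  have hsum : ∀ x, HasSum (fun n => g (T (n + 1) x)) (∑' n, g (T (n + 1) x)) := fun x =>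
    (Summable.of_norm_bounded hsummable fun n => hbound n x).hasSum
  have hpart : ∀ x, Tendsto (fun n => birkhoffSum shift g n (T n x)) atTop
      (𝓝 (∑' n, g (T (n + 1) x))) := fun x => by
    refine (hsum x).tendsto_sum_nat.congr fun n => ?_
    induction n with
    | zero => simp
    | succ n ih => rw [Finset.sum_range_succ, ih, birkhoffSum_succ', hTss, add_comm]
  refine ⟨fun x => -∑' n, g (T (n + 1) x), (continuous_tsum (fun n => hcont.comp (hTcont _))
    hsummable hbound).neg, fun y => ?_⟩
  set x := shift y with hx
  -- Compare the words `i^(n+1)` and `i^n y₀`, both followed by `x`, through their periodisations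
  -- of period `n + 1 + n`.
  set D := C / (1 - ρ) with hD
  have hcmp : ∀ n, |birkhoffSum shift g (n + 1) (T (n + 1) x)
      - birkhoffSum shift g (n + 1) (T n y)| ≤ 3 * D * ρ ^ n := fun n => by
    set N := n + 1 + n with hN
    have htail : shift^[n + 1] (T (n + 1) x) = shift^[n + 1] (T n y) := by
      rw [hTs, Function.iterate_succ_apply', hTs]
    have hzero : ∀ w, birkhoffSum shift g (n + 1) (periodize N w)
        + birkhoffSum shift g n (shift^[n + 1] (periodize N w)) = 0 := fun w => by
      rw [← birkhoffSum_add]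
      exact hper _ _ (by omega) (shift_iterate_periodize N w)
    have hnear : ∀ w, |birkhoffSum shift g (n + 1) w
        - birkhoffSum shift g (n + 1) (periodize N w)| ≤ D * ρ ^ n := fun w =>
      abs_birkhoffSum_sub_le hC hρ0 hρ1 hg n (n + 1) _ _ fun k hk => (periodize_of_lt w hk).symm
    have hmid : |birkhoffSum shift g n (shift^[n + 1] (periodize N (T (n + 1) x)))
        - birkhoffSum shift g n (shift^[n + 1] (periodize N (T n y)))| ≤ D * ρ ^ n := by
      refine abs_birkhoffSum_sub_le hC hρ0 hρ1 hg n n _ _ fun k hk => ?_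
      rw [shift_iterate_apply, shift_iterate_apply]
      rcases lt_or_ge k n with h | h
      · rw [periodize_of_lt _ (by omega), periodize_of_lt _ (by omega)]
        simpa only [shift_iterate_apply] using congrFun htail k
      · have e1 : (k + (n + 1)) % N = k - n := by
          rw [Nat.mod_eq_sub_mod (by omega), Nat.mod_eq_of_lt (by omega)]
          omega
        simp only [periodize, e1]
        rw [hTlt _ _ _ (by omega), hTlt _ _ _ (by omega)]
    have z1 := hzero (T (n + 1) x)
    have z2 := hzero (T n y)
    have n1 := hnear (T (n + 1) x)
    have n2 := hnear (T n y)
    rw [abs_le] at *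
    constructor <;> linarith [n1.1, n1.2, n2.1, n2.2, hmid.1, hmid.2]
  have hlim1 : Tendsto (fun n => birkhoffSum shift g (n + 1) (T (n + 1) x)
      - birkhoffSum shift g (n + 1) (T n y)) atTop (𝓝 0) := by
    refine squeeze_zero_norm hcmp ?_
    simpa using (tendsto_pow_atTop_nhds_zero_of_lt_one hρ0 hρ1).const_mul (3 * D)
  have hlim2 : Tendsto (fun n => birkhoffSum shift g (n + 1) (T (n + 1) x)
      - birkhoffSum shift g (n + 1) (T n y)) atTop
      (𝓝 (∑' n, g (T (n + 1) x) - (∑' n, g (T (n + 1) y) + g y))) := by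
    refine ((hpart x).comp (tendsto_add_atTop_nat 1)).sub
      (((hpart y).add_const (g y)).congr fun n => ?_)
    rw [birkhoffSum_succ, hTs]
  have := tendsto_nhds_unique hlim1 hlim2
  linarith

/-- Birkhoff sums of a coboundary are uniformly bounded. -/
theorem exists_abs_birkhoffSum_sub_le_of_coboundary {f g e : FullShift d → ℝ} (he : Continuous e)
    (h : ∀ x, f x - g x = e x - e (shift x)) :
    ∃ C, 0 ≤ C ∧ ∀ n x, |birkhoffSum shift f n x - birkhoffSum shift g n x| ≤ C := by
  obtain ⟨B, hB⟩ := isCompact_univ.exists_bound_of_continuousOn he.continuousOn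
  have key : ∀ n x, birkhoffSum shift f n x - birkhoffSum shift g n x = e x - e (shift^[n] x) := by
    intro n
    induction n with
    | zero => simp
    | succ n ih =>
      intro x
      rw [birkhoffSum_succ, birkhoffSum_succ, Function.iterate_succ_apply']
      linarith [ih x, h (shift^[n] x)]
  refine ⟨2 * |B|, by positivity, fun n x => ?_⟩
  have b1 := (hB x (mem_univ _)).trans (le_abs_self B)
  have b2 := (hB (shift^[n] x) (mem_univ _)).trans (le_abs_self B)
  rw [Real.norm_eq_abs] at b1 b2
  rw [key, two_mul]
  exact (abs_sub _ _).trans (add_le_add b1 b2)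

end Symbolic

/-! ### The coding map -/

section Symbolic

variable {d : ℕ}

theorem eventually_forall_lt_eq (n : ℕ) (x : FullShift d) : ∀ᶠ y in 𝓝 x, ∀ k < n, y k = x k := by
  have : ∀ᶠ y in 𝓝 x, ∀ k ∈ Finset.range n, y k = x k := by
    rw [Filter.eventually_all_finset]
    intro k _
    exact (continuous_apply k).continuousAt.eventually (f := fun y : FullShift d => y k)
      (p := fun i => i = x k) (by rw [nhds_discrete]; simp)
  filter_upwards [this] with y hy k hk using hy k (Finset.mem_range.2 hk)

/-- A real function whose variation over cylinders of length `n` is at most `b n → 0` is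
continuous. -/
theorem continuous_of_variation_le {g : FullShift d → ℝ} {b : ℕ → ℝ}
    (hb : Tendsto b atTop (𝓝 0))
    (hg : ∀ n x y, (∀ k < n, x k = y k) → |g x - g y| ≤ b n) : Continuous g := by
  refine continuous_iff_continuousAt.2 fun x => Metric.tendsto_nhds.2 fun ε hε => ?_
  obtain ⟨n, hn⟩ := (hb.eventually_lt_const hε).exists
  filter_upwards [eventually_forall_lt_eq n x] with y hy
  exact (hg n y x hy).trans_lt hn

/-- The potential depending only on the first letter of a sequence. -/
def letterPotential (l : Fin d → ℝ) (x : FullShift d) : ℝ := l (x 0)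

theorem birkhoffSum_letterPotential (l : Fin d → ℝ) (n : ℕ) (x : FullShift d) :
    birkhoffSum shift (letterPotential l) n x = ∑ k ∈ Finset.range n, l (x k) := by
  simp [birkhoffSum, letterPotential, shift_iterate_apply]

end Symbolic

namespace ConformalIFS

variable {d : ℕ} (Φ : ConformalIFS d)

theorem codingMap_mem_image (x : FullShift d) (n : ℕ) :
    Φ.codingMap x ∈ wordMap Φ.map (List.ofFn (initWord x n)) '' Φ.X :=
  (Φ.existsUnique_coding x).choose_spec.1 n

theorem codingMap_eq_of_forall_mem {x : FullShift d} {p : ℝ}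
    (h : ∀ n, p ∈ wordMap Φ.map (List.ofFn (initWord x n)) '' Φ.X) : Φ.codingMap x = p :=
  ((Φ.existsUnique_coding x).choose_spec.2 p h).symm

theorem codingMap_mem (x : FullShift d) : Φ.codingMap x ∈ Φ.X := by
  simpa [wordMap] using Φ.codingMap_mem_image x 0

theorem ofFn_initWord_succ (x : FullShift d) (n : ℕ) :
    List.ofFn (initWord x (n + 1)) = x 0 :: List.ofFn (initWord (shift x) n) := by
  rw [List.ofFn_succ]; rfl

theorem codingMap_eq_map_shift (x : FullShift d) :
    Φ.codingMap x = Φ.map (x 0) (Φ.codingMap (shift x)) := by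
  refine Φ.codingMap_eq_of_forall_mem fun n => ?_
  cases n with
  | zero =>
    simpa [wordMap] using interior_subset (Φ.mapsTo (x 0) (Φ.codingMap_mem (shift x)))
  | succ n =>
    rw [ofFn_initWord_succ, wordMap, image_comp]
    exact mem_image_of_mem _ (Φ.codingMap_mem_image (shift x) n)

theorem codingMap_eq_wordMap (x : FullShift d) (n : ℕ) :
    Φ.codingMap x = wordMap Φ.map (List.ofFn (initWord x n)) (Φ.codingMap (shift^[n] x)) := by
  induction n generalizing x with
  | zero => rfl
  | succ n ih =>
    rw [ofFn_initWord_succ, wordMap, Function.comp_apply, Function.iterate_succ_apply, ← ih,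
      ← codingMap_eq_map_shift]

theorem codingMap_mem_interior (x : FullShift d) : Φ.codingMap x ∈ interior Φ.X := by
  rw [codingMap_eq_map_shift]
  exact Φ.mapsTo _ (Φ.codingMap_mem _)

theorem codingMap_mem_limitSet (x : FullShift d) : Φ.codingMap x ∈ Φ.limitSet :=
  mem_iInter.2 fun n => mem_iUnion.2 ⟨_, Φ.codingMap_mem_image x n⟩

theorem limitSet_subset : Φ.limitSet ⊆ Φ.X := fun p hp => by
  obtain ⟨ω, hω⟩ := mem_iUnion.1 (mem_iInter.1 hp 0)
  simpa [wordMap] using hω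

theorem exists_abs_codingMap_sub_le : ∃ C ρ : ℝ, 0 ≤ C ∧ 0 ≤ ρ ∧ ρ < 1 ∧
    ∀ n x y, (∀ k < n, x k = y k) → |Φ.codingMap x - Φ.codingMap y| ≤ C * ρ ^ n := by
  obtain ⟨c, hc1, hc⟩ := Φ.contraction
  refine ⟨Metric.diam Φ.X, c, Metric.diam_nonneg, c.2, hc1, fun n x y hxy => ?_⟩
  have hw : initWord x n = initWord y n := funext fun k => hxy k k.2
  rw [Φ.codingMap_eq_wordMap x n, Φ.codingMap_eq_wordMap y n, hw]
  have h1 := (Φ.lipschitz_wordMap hc (List.ofFn (initWord y n))).dist_le_mul _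
    (Φ.codingMap_mem (shift^[n] x)) _ (Φ.codingMap_mem (shift^[n] y))
  rw [List.length_ofFn, NNReal.coe_pow, Real.dist_eq] at h1
  rw [mul_comm]
  exact h1.trans (mul_le_mul_of_nonneg_left
    (Metric.dist_le_diam_of_mem Φ.isCompact_X.isBounded (Φ.codingMap_mem _) (Φ.codingMap_mem _))
    (by positivity))

theorem continuous_codingMap : Continuous Φ.codingMap := by
  obtain ⟨C, ρ, -, h0, h1, h⟩ := Φ.exists_abs_codingMap_sub_le
  refine continuous_of_variation_le ?_ h
  simpa using (tendsto_pow_atTop_nhds_zero_of_lt_one h0 h1).const_mul C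

/-- Strong separation: the first-level pieces of the limit set are a positive distance apart.
They lie in the pairwise disjoint sets `φ_i (Int X)`, since the generators map `X` into `Int X`. -/
theorem exists_le_abs_codingMap_sub : ∃ δ : ℝ, 0 < δ ∧
    ∀ x y : FullShift d, x 0 ≠ y 0 → δ ≤ |Φ.codingMap x - Φ.codingMap y| := by
  have hcl : IsClosed {p : FullShift d × FullShift d | p.1 0 ≠ p.2 0} :=
    (isClosed_discrete {q : Fin d × Fin d | q.1 ≠ q.2}).preimage
      (f := fun p : FullShift d × FullShift d => (p.1 0, p.2 0)) (by fun_prop)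
  rcases Set.eq_empty_or_nonempty {p : FullShift d × FullShift d | p.1 0 ≠ p.2 0} with he | hne
  · refine ⟨1, one_pos, fun x y hxy => ?_⟩
    have : (x, y) ∈ {p : FullShift d × FullShift d | p.1 0 ≠ p.2 0} := hxy
    rw [he] at this
    exact this.elim
  obtain ⟨⟨a, b⟩, hab, hmin⟩ := hcl.isCompact.exists_isMinOn hne
    (f := fun p : FullShift d × FullShift d => |Φ.codingMap p.1 - Φ.codingMap p.2|)
    (((Φ.continuous_codingMap.comp continuous_fst).sub
      (Φ.continuous_codingMap.comp continuous_snd)).abs.continuousOn)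
  refine ⟨|Φ.codingMap a - Φ.codingMap b|, abs_pos.2 (sub_ne_zero.2 fun h => ?_),
    fun x y hxy => hmin (show (x, y) ∈ _ from hxy)⟩
  refine (Φ.openSet _ _ hab).ne_of_mem (mem_image_of_mem _ (Φ.codingMap_mem_interior (shift a)))
    (mem_image_of_mem _ (Φ.codingMap_mem_interior (shift b))) ?_
  rw [← codingMap_eq_map_shift, ← codingMap_eq_map_shift, h]

/-! ### Systems with first-letter contraction rates -/

/-- `l i < 0` are logarithmic contraction ratios for `Φ` when the distance of two points of the
limit set whose codes split exactly at time `n` is comparable to `exp (l x₁ + ⋯ + l x_n)`. -/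
structure HasLogRatios (l : Fin d → ℝ) : Prop where
  neg : ∀ i, l i < 0
  dist_bounds : ∃ D : ℝ, 0 < D ∧ ∀ (n : ℕ) (x y : FullShift d), (∀ k < n, x k = y k) →
    |Φ.codingMap x - Φ.codingMap y| ≤ D * Real.exp (birkhoffSum shift (letterPotential l) n x) ∧
    (x n ≠ y n →
      Real.exp (birkhoffSum shift (letterPotential l) n x) ≤ D * |Φ.codingMap x - Φ.codingMap y|)

variable {Φ}

theorem IsAffine.exists_hasLogRatios (hΦ : Φ.IsAffine) : ∃ l, Φ.HasLogRatios l := by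
  choose a b hab using hΦ
  have hab' : ∀ i p q, p ∈ Φ.X → q ∈ Φ.X → |Φ.map i p - Φ.map i q| = |a i| * |p - q| := by
    intro i p q hp hq
    rw [hab i p hp, hab i q hq, ← abs_mul]
    ring_nf
  have hX : ∀ i : Fin d, ∃ p ∈ Φ.X, ∃ q ∈ Φ.X, p ≠ q := by
    intro i
    obtain ⟨p, hp⟩ := Φ.isConnected_X.nonempty
    have hX : ∀ᶠ q in 𝓝[≠] Φ.map i p, q ∈ Φ.X :=
      mem_nhdsWithin_of_mem_nhds (mem_interior_iff_mem_nhds.1 (Φ.mapsTo i hp))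
    obtain ⟨q, hq, hne⟩ := (hX.and self_mem_nhdsWithin).exists
    exact ⟨q, hq, _, interior_subset (Φ.mapsTo i hp), hne⟩
  have ha0 : ∀ i, 0 < |a i| := by
    intro i
    obtain ⟨p, hp, q, hq, hne⟩ := hX i
    refine abs_pos.2 fun h0 => hne (Φ.injOn i hp hq ?_)
    rw [hab i p hp, hab i q hq, h0, zero_mul, zero_mul]
  have ha1 : ∀ i, |a i| < 1 := by
    intro i
    obtain ⟨p, hp, q, hq, hne⟩ := hX i
    obtain ⟨c, hc1, hc⟩ := Φ.contraction
    have h := (hc i).dist_le_mul p hp q hq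
    rw [Real.dist_eq, Real.dist_eq, hab' i p q hp hq] at h
    exact (le_of_mul_le_mul_right h (abs_pos.2 (sub_ne_zero.2 hne))).trans_lt hc1
  have key : ∀ (n : ℕ) (x y : FullShift d), (∀ k < n, x k = y k) →
      |Φ.codingMap x - Φ.codingMap y|
        = Real.exp (birkhoffSum shift (letterPotential fun i => Real.log |a i|) n x)
          * |Φ.codingMap (shift^[n] x) - Φ.codingMap (shift^[n] y)| := by
    intro n
    induction n with
    | zero => simp
    | succ n ih =>
      intro x y hxy
      rw [Φ.codingMap_eq_map_shift x, Φ.codingMap_eq_map_shift y, ← hxy 0 (by omega),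
        hab' _ _ _ (Φ.codingMap_mem _) (Φ.codingMap_mem _),
        ih (shift x) (shift y) fun k hk => hxy (k + 1) (by omega), birkhoffSum_succ', Real.exp_add,
        letterPotential, Real.exp_log (ha0 _), mul_assoc]
      rfl
  obtain ⟨δ, hδ, hsep⟩ := Φ.exists_le_abs_codingMap_sub
  refine ⟨fun i => Real.log |a i|, fun i => Real.log_neg (ha0 i) (ha1 i),
    Metric.diam Φ.X + δ⁻¹, by positivity, fun n x y hxy => ⟨?_, fun hn => ?_⟩⟩
  · rw [key n x y hxy, mul_comm]
    have h1 : |Φ.codingMap (shift^[n] x) - Φ.codingMap (shift^[n] y)| ≤ Metric.diam Φ.X :=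
      Metric.dist_le_diam_of_mem Φ.isCompact_X.isBounded (Φ.codingMap_mem _) (Φ.codingMap_mem _)
    have h2 : 0 < δ⁻¹ := by positivity
    gcongr
    linarith
  · rw [key n x y hxy]
    have h1 : δ ≤ |Φ.codingMap (shift^[n] x) - Φ.codingMap (shift^[n] y)| :=
      hsep _ _ (by simpa [shift_iterate_apply] using hn)
    have h2 : 1 ≤ (Metric.diam Φ.X + δ⁻¹)
        * |Φ.codingMap (shift^[n] x) - Φ.codingMap (shift^[n] y)| := by
      calc (1 : ℝ) = (0 + δ⁻¹) * δ := by field_simp; ring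
        _ ≤ _ := by gcongr; exact Metric.diam_nonneg
    rw [mul_left_comm]
    exact le_mul_of_one_le_right (Real.exp_pos _).le h2

/-- A bi-Lipschitz conjugacy intertwines the coding maps, so that it transports contraction
ratios. -/
theorem HasLogRatios.of_isDeformation {Ψ : ConformalIFS d} {l : Fin d → ℝ} (hl : Φ.HasLogRatios l)
    (h : IsDeformation Φ Ψ) : Ψ.HasLogRatios l := by
  obtain ⟨h, hbij, ⟨K, hK, hlip⟩, hconj⟩ := h
  have hiter : ∀ n x, h (Φ.codingMap x)
      = wordMap Ψ.map (List.ofFn (initWord x n)) (h (Φ.codingMap (shift^[n] x))) := by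
    intro n
    induction n with
    | zero => intro x; rfl
    | succ n ih =>
      intro x
      rw [ofFn_initWord_succ, wordMap, Function.comp_apply, Function.iterate_succ_apply, ← ih,
        hconj _ _ (Φ.codingMap_mem_limitSet _), ← codingMap_eq_map_shift]
  have hcode : ∀ x, Ψ.codingMap x = h (Φ.codingMap x) := fun x =>
    Ψ.codingMap_eq_of_forall_mem fun n => by
      rw [hiter n x]
      exact mem_image_of_mem _ (Ψ.limitSet_subset (hbij.mapsTo (Φ.codingMap_mem_limitSet _)))
  obtain ⟨hneg, D, hD, hb⟩ := hl
  refine ⟨hneg, K * D, by positivity, fun n x y hxy => ?_⟩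
  obtain ⟨b1, b2⟩ := hb n x y hxy
  obtain ⟨l1, l2⟩ := hlip _ (Φ.codingMap_mem_limitSet x) _ (Φ.codingMap_mem_limitSet y)
  rw [hcode, hcode]
  refine ⟨l2.trans ?_, fun hn => (b2 hn).trans ?_⟩
  · rw [mul_assoc]; gcongr
  · rw [inv_mul_le_iff₀ hK] at l1
    rw [mul_comm K, mul_assoc]
    gcongr

/-! ### Regularity of the geometric potential -/

variable (Φ)

theorem contDiffAt_map (i : Fin d) {t : ℝ} (ht : t ∈ interior Φ.X) :
    ContDiffAt ℝ 2 (Φ.map i) t ∧ deriv (Φ.map i) t ≠ 0 := by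
  obtain ⟨U, ext, hU, -, hXU, -, hdiff, hne, hext, -⟩ := Φ.conformal
  have htU : (t : ℂ) ∈ U := hXU t (interior_subset ht)
  have heq : Φ.map i =ᶠ[𝓝 t] fun s : ℝ => (ext i s).re := by
    filter_upwards [isOpen_interior.mem_nhds ht] with s hs
    rw [hext i s (interior_subset hs), Complex.ofReal_re]
  have hC : ContDiffAt ℂ 2 (ext i) t :=
    ((hdiff i).analyticAt (hU.mem_nhds htU)).contDiffAt
  refine ⟨hC.real_of_complex.congr_of_eventuallyEq heq, fun h0 => ?_⟩
  have hd : HasDerivAt (ext i) (deriv (ext i) t) t :=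
    ((hdiff i).differentiableAt (hU.mem_nhds htU)).hasDerivAt
  have hreal : HasDerivAt (fun s : ℝ => ext i s) (deriv (ext i) t) t := hd.comp_ofReal
  have hmap : HasDerivAt (Φ.map i) (deriv (Φ.map i) t) t :=
    ((hC.real_of_complex.congr_of_eventuallyEq heq).differentiableAt (by norm_num)).hasDerivAt
  have hmap' : HasDerivAt (fun s : ℝ => ext i s) ((deriv (Φ.map i) t : ℝ) : ℂ) t := by
    refine hmap.ofReal_comp.congr_of_eventuallyEq ?_
    filter_upwards [isOpen_interior.mem_nhds ht] with s hs
    exact hext i s (interior_subset hs)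
  refine hne i t htU ?_
  rw [hreal.unique hmap', h0, Complex.ofReal_zero]

/-- The geometric potential has exponentially decaying variations, because `log |φ_i'|` is
Lipschitz on the limit set. -/
theorem exists_abs_geomPotential_sub_le : ∃ C ρ : ℝ, 0 ≤ C ∧ 0 ≤ ρ ∧ ρ < 1 ∧
    ∀ n x y, (∀ k ≤ n, x k = y k) → |Φ.geomPotential x - Φ.geomPotential y| ≤ C * ρ ^ n := by
  obtain ⟨C, ρ, hC, h0, h1, hb⟩ := Φ.exists_abs_codingMap_sub_le
  have hL : ∀ i, ∃ K : ℝ≥0, LipschitzOnWith K (fun t => Real.log (deriv (Φ.map i) t))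
      (range Φ.codingMap) := by
    intro i
    refine LocallyLipschitzOn.exists_lipschitzOnWith_of_compact
      (isCompact_range Φ.continuous_codingMap) ?_
    rintro _ ⟨x, rfl⟩
    obtain ⟨h2, hne⟩ := Φ.contDiffAt_map i (Φ.codingMap_mem_interior x)
    have hd : ContDiffAt ℝ 1 (deriv (Φ.map i)) (Φ.codingMap x) := h2.derivWithin (by norm_num)
    obtain ⟨K, t, ht, hK⟩ := (hd.log hne).exists_lipschitzOnWith
    exact ⟨K, t, mem_nhdsWithin_of_mem_nhds ht, hK⟩
  choose K hK using hL
  refine ⟨(∑ i, (K i : ℝ)) * C, ρ, by positivity, h0, h1, fun n x y hxy => ?_⟩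
  have hk := (hK (x 0)).dist_le_mul _ (mem_range_self (shift x)) _ (mem_range_self (shift y))
  rw [Real.dist_eq, Real.dist_eq] at hk
  rw [geomPotential, geomPotential, ← hxy 0 (by omega), Real.log_abs, Real.log_abs, mul_assoc]
  have hs : (K (x 0) : ℝ) ≤ ∑ i, (K i : ℝ) :=
    Finset.single_le_sum (f := fun i => (K i : ℝ)) (fun i _ => (K i).2) (Finset.mem_univ _)
  refine hk.trans (mul_le_mul hs (hb n _ _ fun k hk => hxy (k + 1) (by omega)) (abs_nonneg _)
    (by positivity))

/-- The chain rule: Birkhoff sums of the geometric potential are logarithmic derivatives of the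
compositions of generators. -/
theorem exists_hasDerivAt_wordMap (n : ℕ) (x : FullShift d) : ∃ m : ℝ, m ≠ 0 ∧
    HasDerivAt (wordMap Φ.map (List.ofFn (initWord x n))) m (Φ.codingMap (shift^[n] x)) ∧
    birkhoffSum shift Φ.geomPotential n x = Real.log |m| := by
  induction n generalizing x with
  | zero => exact ⟨1, one_ne_zero, hasDerivAt_id _, by simp⟩
  | succ n ih =>
    obtain ⟨m, hm, hd, hs⟩ := ih (shift x)
    obtain ⟨h2, hne⟩ := Φ.contDiffAt_map (x 0) (Φ.codingMap_mem_interior (shift x))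
    refine ⟨deriv (Φ.map (x 0)) (Φ.codingMap (shift x)) * m, mul_ne_zero hne hm, ?_, ?_⟩
    · rw [ofFn_initWord_succ, wordMap, Function.iterate_succ_apply]
      refine HasDerivAt.comp _ ?_ hd
      rw [← codingMap_eq_wordMap]
      exact (h2.differentiableAt (by norm_num)).hasDerivAt
    · rw [birkhoffSum_succ', hs, abs_mul, Real.log_mul (abs_ne_zero.2 hne) (abs_ne_zero.2 hm),
        geomPotential]

end ConformalIFS

/-! ### Essentially affine systems have potentials cohomologous to first-letter potentials -/

/-- A bounded sequence whose increments converge has increments tending to `0`. -/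
theorem eq_zero_of_tendsto_sub_of_bounded {s : ℕ → ℝ} {L B : ℝ} (hB : ∀ n, |s n| ≤ B)
    (h : Tendsto (fun n => s (n + 1) - s n) atTop (𝓝 L)) : L = 0 := by
  refine tendsto_nhds_unique h.cesaro ?_
  simp_rw [Finset.sum_range_sub]
  refine squeeze_zero_norm (a := fun n : ℕ => (n : ℝ)⁻¹ * (2 * B)) (fun n => ?_) ?_
  · rw [norm_mul, norm_inv, Real.norm_natCast, Real.norm_eq_abs, two_mul]
    gcongr
    exact (abs_sub _ _).trans (add_le_add (hB _) (hB _))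
  · simpa using tendsto_inv_atTop_nhds_zero_nat.mul_const (2 * B)

namespace ConformalIFS

variable {d : ℕ} {Φ : ConformalIFS d} {l : Fin d → ℝ}


/-- On a periodic orbit the geometric potential and the logarithmic contraction ratios have the
same sum. Both give the exponential rate at which the images of a nearby point of the limit set
under the iterates of the return map `F` approach its fixed point: the former because it is
`log |F'|`, the latter by the metric characterisation of the contraction ratios. -/
theorem HasLogRatios.birkhoffSum_eq_of_periodic [Nontrivial (Fin d)] (hl : Φ.HasLogRatios l)
    {n : ℕ} {x : FullShift d} (hn : 0 < n) (hx : shift^[n] x = x) :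
    birkhoffSum shift Φ.geomPotential n x = birkhoffSum shift (letterPotential l) n x := by
  obtain ⟨C, ρ, -, h0, h1, hcode⟩ := Φ.exists_abs_codingMap_sub_le
  obtain ⟨-, D, hD, hb⟩ := hl
  obtain ⟨m, hm, hF, hI⟩ := Φ.exists_hasDerivAt_wordMap n x
  rw [hx] at hF
  set S := birkhoffSum shift (letterPotential l) n x with hS
  set F := wordMap Φ.map (List.ofFn (initWord x n)) with hFdef
  set p := Φ.codingMap x with hp
  have hfix : F p = p := by
    have := Φ.codingMap_eq_wordMap x n
    rw [hx] at this
    exact this.symm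
  obtain ⟨j, hj⟩ := exists_ne (x 0)
  -- `y k` follows `x` for exactly `k` periods.
  set y : ℕ → FullShift d := fun k => splice (k * n) x fun _ => j with hy
  have hxmul : ∀ k, shift^[k * n] x = x := fun k => by
    rw [mul_comm, Function.iterate_mul]
    exact Function.iterate_fixed hx k
  have hSk : ∀ k, birkhoffSum shift (letterPotential l) (k * n) x = k * S := by
    intro k
    induction k with
    | zero => simp
    | succ k ih =>
      rw [Nat.succ_mul, birkhoffSum_add, ih, hxmul]
      push_cast
      ring
  have hxy : ∀ k, ∀ q < k * n, x q = y k q := fun k q hq => (splice_of_lt _ _ hq).symm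
  have hne : ∀ k, x (k * n) ≠ y k (k * n) := fun k => by
    have e1 : x (k * n) = x 0 := by simpa [shift_iterate_apply] using congrFun (hxmul k) 0
    have e2 : y k (k * n) = j := by simp [hy, splice]
    rw [e1, e2]
    exact hj.symm
  have hshift : ∀ k, shift^[n] (y (k + 1)) = y k := fun k => by
    funext q
    have e : x (q + n) = x q := by simpa [shift_iterate_apply] using congrFun hx q
    have e' : q + n < (k + 1) * n ↔ q < k * n := by rw [Nat.succ_mul]; omega
    simp only [shift_iterate_apply, hy, splice, e', e]
  have hrec : ∀ k, Φ.codingMap (y (k + 1)) = F (Φ.codingMap (y k)) := fun k => by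
    have hw : initWord (y (k + 1)) n = initWord x n := funext fun q =>
      (hxy (k + 1) q (q.2.trans_le (by rw [Nat.succ_mul]; omega))).symm
    rw [Φ.codingMap_eq_wordMap _ n, hw, hshift]
  have hdist : ∀ k, 0 < |p - Φ.codingMap (y k)| := fun k => by
    have := (hb _ _ _ (hxy k)).2 (hne k)
    have h3 := (Real.exp_pos _).trans_le this
    exact pos_of_mul_pos_right h3 hD.le
  have htend : Tendsto (fun k => Φ.codingMap (y k)) atTop (𝓝[≠] p) := by
    refine tendsto_nhdsWithin_iff.2 ⟨?_, Eventually.of_forall fun k h => ?_⟩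
    · refine tendsto_iff_dist_tendsto_zero.2 (squeeze_zero (fun _ => dist_nonneg)
        (fun k => ?_) (g := fun k => C * ρ ^ k) ?_)
      · rw [dist_comm]
        exact hcode k x (y k) fun q hq => hxy k q (hq.trans_le (Nat.le_mul_of_pos_right _ hn))
      · simpa using (tendsto_pow_atTop_nhds_zero_of_lt_one h0 h1).const_mul C
    · have := hdist k
      rw [show Φ.codingMap (y k) = p from h] at this
      simp at this
  have hslope : Tendsto (fun k => Real.log |slope F p (Φ.codingMap (y k))|) atTop
      (𝓝 (Real.log |m|)) :=
    (Real.continuousAt_log (abs_ne_zero.2 hm)).tendsto.comp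
      ((hasDerivAt_iff_tendsto_slope.1 hF).comp htend).abs
  have hzero := eq_zero_of_tendsto_sub_of_bounded
    (s := fun k => Real.log |p - Φ.codingMap (y k)| - k * S) (L := Real.log |m| - S)
    (B := |Real.log D|) (fun k => ?_) ?_
  · rw [hI]
    linarith
  · obtain ⟨u1, u2⟩ := hb _ _ _ (hxy k)
    replace u2 := u2 (hne k)
    rw [hSk] at u1 u2
    have v1 := Real.log_le_log (hdist k) u1
    have v2 := Real.log_le_log (Real.exp_pos _) u2
    rw [Real.log_mul hD.ne' (Real.exp_pos _).ne', Real.log_exp] at v1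
    rw [Real.log_mul hD.ne' (hdist k).ne', Real.log_exp] at v2
    refine (abs_le.2 ⟨?_, ?_⟩ : _ ≤ Real.log D).trans (le_abs_self _)
    · linarith
    · linarith
  · refine (hslope.sub_const S).congr fun k => ?_
    have h3 : |slope F p (Φ.codingMap (y k))|
        = |p - Φ.codingMap (y (k + 1))| / |p - Φ.codingMap (y k)| := by
      rw [slope_def_field, hfix, ← hrec, abs_div, abs_sub_comm, abs_sub_comm _ p]
    rw [h3, Real.log_div (hdist _).ne' (hdist _).ne']
    push_cast
    ring

/-- The geometric potential of an essentially affine system is continuously cohomologous to the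
potential given by the logarithmic contraction ratios of its affine model. -/
theorem IsEssentiallyAffine.exists_hasLogRatios [Nontrivial (Fin d)]
    (hΦ : Φ.IsEssentiallyAffine) :
    ∃ l, Φ.HasLogRatios l ∧ Cohomologous Φ.geomPotential (letterPotential l) := by
  obtain ⟨Φ₀, haff, hdef⟩ := hΦ
  obtain ⟨l, hl₀⟩ := haff.exists_hasLogRatios
  have hl := hl₀.of_isDeformation hdef
  obtain ⟨C, ρ, hC, h0, h1, hvar⟩ := Φ.exists_abs_geomPotential_sub_le
  obtain ⟨i, -⟩ := exists_pair_ne (Fin d)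
  have hvar' : ∀ n x y, (∀ k ≤ n, x k = y k) →
      |(Φ.geomPotential - letterPotential l) x - (Φ.geomPotential - letterPotential l) y|
        ≤ C * ρ ^ n := fun n x y hxy => by
    have h2 : letterPotential l x = letterPotential l y := congrArg l (hxy 0 (Nat.zero_le n))
    rw [Pi.sub_apply, Pi.sub_apply, h2, sub_sub_sub_cancel_right]
    exact hvar n x y hxy
  have hcont : Continuous (Φ.geomPotential - letterPotential l) := by
    refine continuous_iff_continuousAt.2 fun x => Metric.tendsto_nhds.2 fun ε hε => ?_
    have hlim : Tendsto (fun n => C * ρ ^ n) atTop (𝓝 0) := by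
      simpa using (tendsto_pow_atTop_nhds_zero_of_lt_one h0 h1).const_mul C
    obtain ⟨n, hn⟩ := (hlim.eventually_lt_const hε).exists
    filter_upwards [eventually_forall_lt_eq (n + 1) x] with y hy
    exact (hvar' n y x fun k hk => hy k (by omega)).trans_lt hn
  obtain ⟨e, he, h⟩ := exists_coboundary_of_periodic_sums_eq_zero i hC h0 h1 hcont hvar'
    fun n x hn hx => by
      rw [birkhoffSum_sub, hl.birkhoffSum_eq_of_periodic hn hx, sub_self]
  exact ⟨l, hl, e, he, h⟩

end ConformalIFS

/-! ### Pressure -/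

section Pressure

variable {d : ℕ}

/-- The pressure of a potential whose Birkhoff sums stay within bounded distance of those of a
first-letter potential `l` is `log ∑ exp l_i`. -/
theorem pressure_eq_log_sum_exp [Nonempty (Fin d)] {f : FullShift d → ℝ} {l : Fin d → ℝ} {C : ℝ}
    (h : ∀ n x, |birkhoffSum shift f n x - birkhoffSum shift (letterPotential l) n x| ≤ C) :
    pressure f = Real.log (∑ i, Real.exp (l i)) := by
  have hne : ∀ {n : ℕ} (ω : Fin n → Fin d), (cylinder ω).Nonempty := fun {n} ω =>
    ⟨fun k => if hk : k < n then ω ⟨k, hk⟩ else Classical.arbitrary _, fun k => by simp⟩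
  have hsum : ∀ {n : ℕ} (ω : Fin n → Fin d), ∀ x ∈ cylinder ω,
      birkhoffSum shift (letterPotential l) n x = ∑ k, l (ω k) := fun {n} ω x hx => by
    rw [birkhoffSum_letterPotential, Finset.sum_range]
    exact Finset.sum_congr rfl fun k _ => by rw [hx k]
  have hsup : ∀ {n : ℕ} (ω : Fin n → Fin d),
      |sSup ((fun x => birkhoffSum shift f n x) '' cylinder ω) - ∑ k, l (ω k)| ≤ C := by
    intro n ω
    have hup : ∀ y ∈ (fun x => birkhoffSum shift f n x) '' cylinder ω,
        y ≤ ∑ k, l (ω k) + C := by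
      rintro _ ⟨x, hx, rfl⟩
      have := (abs_le.1 (h n x)).2
      rw [hsum ω x hx] at this
      simp only
      linarith
    obtain ⟨x, hx⟩ := hne ω
    have h1 := csSup_le ((hne ω).image _) hup
    have h2 := le_csSup ⟨_, hup⟩ (mem_image_of_mem (fun x => birkhoffSum shift f n x) hx)
    have h3 := (abs_le.1 (h n x)).1
    rw [hsum ω x hx] at h3
    exact abs_le.2 ⟨by linarith, by linarith⟩
  set Z := ∑ i, Real.exp (l i) with hZ
  have hZpos : 0 < Z := Finset.sum_pos (fun i _ => Real.exp_pos _) Finset.univ_nonempty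
  have hpow : ∀ n : ℕ, ∑ ω : Fin n → Fin d, Real.exp (∑ k, l (ω k)) = Z ^ n := fun n => by
    rw [hZ, Fintype.sum_pow]
    simp_rw [Real.exp_sum]
  refine Tendsto.limUnder_eq ?_
  have hlog : ∀ n : ℕ, |Real.log (∑ ω : Fin n → Fin d,
      Real.exp (sSup ((fun x => birkhoffSum shift f n x) '' cylinder ω))) - n * Real.log Z|
        ≤ C := fun n => by
    have hpos : 0 < ∑ ω : Fin n → Fin d,
        Real.exp (sSup ((fun x => birkhoffSum shift f n x) '' cylinder ω)) :=
      Finset.sum_pos (fun i _ => Real.exp_pos _) Finset.univ_nonempty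
    have hup : ∑ ω : Fin n → Fin d,
        Real.exp (sSup ((fun x => birkhoffSum shift f n x) '' cylinder ω)) ≤ Real.exp C * Z ^ n := by
      rw [← hpow, Finset.mul_sum]
      refine Finset.sum_le_sum fun ω _ => ?_
      rw [← Real.exp_add]
      exact Real.exp_le_exp.2 (by linarith [(abs_le.1 (hsup ω)).2])
    have hlow : Real.exp (-C) * Z ^ n ≤ ∑ ω : Fin n → Fin d,
        Real.exp (sSup ((fun x => birkhoffSum shift f n x) '' cylinder ω)) := by
      rw [← hpow, Finset.mul_sum]
      refine Finset.sum_le_sum fun ω _ => ?_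
      rw [← Real.exp_add]
      exact Real.exp_le_exp.2 (by linarith [(abs_le.1 (hsup ω)).1])
    have l1 := Real.log_le_log hpos hup
    have l2 := Real.log_le_log (by positivity) hlow
    rw [Real.log_mul (Real.exp_pos _).ne' (by positivity), Real.log_exp, Real.log_pow] at l1 l2
    exact abs_le.2 ⟨by linarith, by linarith⟩
  refine tendsto_iff_dist_tendsto_zero.2 (squeeze_zero' (Eventually.of_forall fun _ => dist_nonneg)
    (g := fun n : ℕ => (n : ℝ)⁻¹ * C) ?_ (by simpa using tendsto_inv_atTop_nhds_zero_nat.mul_const C))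
  filter_upwards [eventually_gt_atTop 0] with n hn
  have hn' : (0 : ℝ) < n := by exact_mod_cast hn
  rw [Real.dist_eq, one_div, show ∀ a : ℝ, (n : ℝ)⁻¹ * a - Real.log Z
    = (n : ℝ)⁻¹ * (a - n * Real.log Z) from fun a => by field_simp, abs_mul,
    abs_of_pos (inv_pos.2 hn')]
  exact mul_le_mul_of_nonneg_left (hlog n) (by positivity)

theorem Cohomologous.exists_abs_birkhoffSum_sub_le {f g : FullShift d → ℝ}
    (h : Cohomologous f g) :
    ∃ C, 0 ≤ C ∧ ∀ n x, |birkhoffSum shift f n x - birkhoffSum shift g n x| ≤ C :=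
  let ⟨_, he, h⟩ := h
  exists_abs_birkhoffSum_sub_le_of_coboundary he h

theorem Cohomologous.const_mul {f g : FullShift d → ℝ} (h : Cohomologous f g) (c : ℝ) :
    Cohomologous (fun x => c * f x) (fun x => c * g x) := by
  obtain ⟨e, he, h⟩ := h
  refine ⟨fun x => c * e x, continuous_const.mul he, fun x => ?_⟩
  rw [← mul_sub, ← mul_sub, h]

/-- `P_Φ(u) = log ∑ exp (u l_i)` for a system with logarithmic contraction ratios `l`. -/
theorem ConformalIFS.P_eq_log_sum_exp [Nonempty (Fin d)] {Φ : ConformalIFS d} {l : Fin d → ℝ}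
    (h : Cohomologous Φ.geomPotential (letterPotential l)) (u : ℝ) :
    Φ.P u = Real.log (∑ i, Real.exp (u * l i)) := by
  obtain ⟨C, -, hC⟩ := (h.const_mul u).exists_abs_birkhoffSum_sub_le
  exact pressure_eq_log_sum_exp hC

end Pressure

/-! ### Bernoulli measures and uniqueness of invariant Gibbs measures -/

section Bernoulli

variable {d : ℕ}

theorem measurable_shift : Measurable (shift : FullShift d → FullShift d) :=
  measurable_pi_iff.2 fun n => measurable_pi_apply (n + 1)

/-- The Bernoulli measure on the full shift with marginal `ν`. -/
def bernoulliMeasure (ν : Measure (Fin d)) : Measure (FullShift d) :=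
  Measure.infinitePi fun _ => ν

variable (ν : Measure (Fin d)) [IsProbabilityMeasure ν]

instance : IsProbabilityMeasure (bernoulliMeasure ν) :=
  inferInstanceAs (IsProbabilityMeasure (Measure.infinitePi fun _ : ℕ => ν))

theorem measurableSet_cylinder {n : ℕ} (ω : Fin n → Fin d) : MeasurableSet (cylinder ω) := by
  have : cylinder ω = ⋂ k : Fin n, {y : FullShift d | y k = ω k} := by ext; simp [cylinder]
  rw [this]
  exact MeasurableSet.iInter fun k =>
    (measurableSet_singleton (ω k)).preimage (measurable_pi_apply (k : ℕ))

theorem bernoulliMeasure_real_cylinder (x : FullShift d) (n : ℕ) :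
    (bernoulliMeasure ν).real (cylinder (initWord x n)) = ∏ k ∈ Finset.range n, ν.real {x k} := by
  have : cylinder (initWord x n) = Set.pi (Finset.range n) fun k => {x k} := by
    ext y
    simp only [cylinder, initWord, Set.mem_pi, Finset.coe_range, mem_Iio, mem_ofPred_eq,
      mem_singleton_iff]
    exact ⟨fun h k hk => h ⟨k, hk⟩, fun h k => h k k.2⟩
  rw [this, measureReal_def, bernoulliMeasure,
    Measure.infinitePi_pi _ fun _ _ => measurableSet_singleton _, ENNReal.toReal_prod]
  rfl

theorem measurePreserving_shift_bernoulliMeasure :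
    MeasurePreserving shift (bernoulliMeasure ν) (bernoulliMeasure ν) := by
  refine ⟨measurable_shift, Measure.eq_infinitePi _ fun s t ht => ?_⟩
  have hs : shift ⁻¹' (Set.pi s t)
      = Set.pi (s.map (addRightEmbedding 1)) fun k => t (k - 1) := by
    ext x
    simp [Set.mem_pi, shift]
  rw [Measure.map_apply measurable_shift
    (MeasurableSet.pi s.countable_toSet fun i _ => ht i), hs, bernoulliMeasure,
    Measure.infinitePi_pi _ fun i _ => ht _, Finset.prod_map]
  simp

/-- Bernoulli measures are ergodic: shift-invariant sets belong to the tail σ-algebra of the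
coordinate process, so that Kolmogorov's zero-one law applies. -/
theorem ergodic_bernoulliMeasure : Ergodic shift (bernoulliMeasure ν) := by
  refine ⟨measurePreserving_shift_bernoulliMeasure ν, ⟨fun A hA hinv => ?_⟩⟩
  set 𝓕 : ℕ → MeasurableSpace (FullShift d) := fun n =>
    MeasurableSpace.comap (fun x : FullShift d => x n) inferInstance with h𝓕
  have hle : ∀ n, 𝓕 n ≤ (inferInstance : MeasurableSpace (FullShift d)) :=
    fun n => (measurable_pi_apply n).comap_le
  have hind : ProbabilityTheory.iIndep 𝓕 (bernoulliMeasure ν) :=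
    (ProbabilityTheory.iIndepFun_iff_iIndep _ _ _).1
      (ProbabilityTheory.iIndepFun_infinitePi (P := fun _ : ℕ => ν) (X := fun _ : ℕ => id)
        fun _ => measurable_id)
  have htail : MeasurableSet[limsup 𝓕 atTop] A := by
    rw [limsup_eq_iInf_iSup_of_nat', MeasurableSpace.measurableSet_iInf]
    intro n
    have hit : shift^[n] ⁻¹' A = A := by
      induction n with
      | zero => rfl
      | succ n ih => rw [Function.iterate_succ, preimage_comp, ih, hinv]
    have hmeas : @Measurable _ _ (⨆ k, 𝓕 (k + n)) _ (shift^[n] : FullShift d → FullShift d) := by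
      refine @measurable_pi_iff _ _ _ (⨆ k, 𝓕 (k + n)) _ _ |>.2 fun k => ?_
      simp_rw [shift_iterate_apply]
      exact (comap_measurable _).mono (le_iSup (fun k => 𝓕 (k + n)) k) le_rfl
    rw [← hit]
    exact hmeas hA
  rw [eventuallyConst_set', ae_eq_empty, ae_eq_univ]
  rcases ProbabilityTheory.measure_zero_or_one_of_measurableSet_limsup_atTop hle hind htail with
    h | h
  · exact Or.inl h
  · exact Or.inr ((prob_compl_eq_zero_iff hA).2 h)

/-- Domination on cylinders implies domination: an open set is the increasing union of the unions
of the cylinders of length `n` contained in it. -/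
theorem absolutelyContinuous_of_cylinder_le {μ₁ μ₂ : Measure (FullShift d)}
    [IsFiniteMeasure μ₁] [IsFiniteMeasure μ₂] {C : ℝ≥0}
    (h : ∀ (n : ℕ) (x : FullShift d),
      μ₁ (cylinder (initWord x n)) ≤ C * μ₂ (cylinder (initWord x n))) : μ₁ ≪ μ₂ := by
  have hopen : ∀ U : Set (FullShift d), IsOpen U → μ₁ U ≤ C * μ₂ U := by
    intro U hU
    set V : ℕ → Set (FullShift d) := fun n => {x | cylinder (initWord x n) ⊆ U} with hV
    have hself : ∀ (n : ℕ) (x : FullShift d), x ∈ cylinder (initWord x n) := fun n x k => rfl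
    have hVU : U = ⋃ n, V n := by
      ext x
      refine ⟨fun hx => mem_iUnion.2 ?_, fun hx => ?_⟩
      · obtain ⟨n, hn⟩ : ∃ n, ∀ y : FullShift d, (∀ k < n, y k = x k) → y ∈ U := by
          obtain ⟨I, u, hu, hsub⟩ := isOpen_pi_iff.1 hU x hx
          refine ⟨I.sup id + 1, fun y hy => hsub fun k hk => ?_⟩
          rw [hy k (Nat.lt_succ_of_le (Finset.le_sup (f := id) hk))]
          exact (hu k hk).2
        exact ⟨n, fun y hy => hn y fun k hk => hy ⟨k, hk⟩⟩
      · obtain ⟨n, hn⟩ := mem_iUnion.1 hx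
        exact hn (hself n x)
    have hmono : Monotone V := fun n m hnm x hx =>
      Subset.trans (fun y hy (k : Fin n) => hy ⟨k, k.2.trans_le hnm⟩) hx
    have hVle : ∀ n, μ₁ (V n) ≤ C * μ₂ (V n) := by
      intro n
      classical
      have hdec : V n = ⋃ ω ∈ (Finset.univ.filter fun ω : Fin n → Fin d =>
          (cylinder ω).Nonempty ∧ cylinder ω ⊆ U), cylinder ω := by
        ext x
        simp only [Finset.mem_filter, Finset.mem_univ, true_and, mem_iUnion, exists_prop]
        constructor
        · intro hx
          exact ⟨initWord x n, ⟨⟨x, hself n x⟩, hx⟩, hself n x⟩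
        · rintro ⟨ω, ⟨-, hω⟩, hx⟩
          have : initWord x n = ω := funext hx
          exact (this ▸ hω : cylinder (initWord x n) ⊆ U)
      have hdisj : ∀ s : Set (Fin n → Fin d), s.PairwiseDisjoint fun ω => cylinder ω := by
        intro s ω _ η _ hne
        refine Set.disjoint_left.2 fun x hx hx' => hne (funext fun k => ?_)
        rw [← hx k, ← hx' k]
      rw [hdec, measure_biUnion_finset (hdisj _) fun ω _ => measurableSet_cylinder ω,
        measure_biUnion_finset (hdisj _) fun ω _ => measurableSet_cylinder ω, Finset.mul_sum]
      refine Finset.sum_le_sum fun ω hω => ?_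
      obtain ⟨x, hx⟩ := (Finset.mem_filter.1 hω).2.1
      have : initWord x n = ω := funext hx
      rw [← this]
      exact h n x
    rw [hVU, hmono.measure_iUnion, hmono.measure_iUnion, ENNReal.mul_iSup]
    exact iSup_mono hVle
  intro A hA
  by_contra hne
  have hpos : μ₂ A < μ₁ A / (C + 1) := by
    rw [hA]
    exact ENNReal.div_pos hne (by simp)
  obtain ⟨U, hAU, hU, hlt⟩ := A.exists_isOpen_lt_of_lt _ hpos
  refine ((measure_mono hAU).trans ((hopen U hU).trans ?_)).not_gt (ENNReal.mul_lt_of_lt_div' hlt)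
  gcongr
  exact le_self_add

/-- A potential whose Birkhoff sums are within bounded distance of those of the first-letter
potential `log ν{i}` has the Bernoulli measure of `ν` as its only invariant Gibbs measure. -/
theorem isInvariantGibbs_iff_eq_bernoulliMeasure {f : FullShift d → ℝ} {l : Fin d → ℝ} {C : ℝ}
    (hν : ∀ i, ν.real {i} = Real.exp (l i))
    (h : ∀ n x, |birkhoffSum shift f n x - birkhoffSum shift (letterPotential l) n x| ≤ C)
    (μ : Measure (FullShift d)) :
    IsInvariantGibbs f μ ↔ μ = bernoulliMeasure ν := by
  have hcyl : ∀ n x, (bernoulliMeasure ν).real (cylinder (initWord x n))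
      = Real.exp (birkhoffSum shift (letterPotential l) n x) := fun n x => by
    rw [bernoulliMeasure_real_cylinder, birkhoffSum_letterPotential, Real.exp_sum]
    exact Finset.prod_congr rfl fun k _ => hν _
  constructor
  · rintro ⟨hprob, hinv, K, hK, hμ⟩
    refine (ergodic_bernoulliMeasure ν).eq_of_absolutelyContinuous hinv
      (absolutelyContinuous_of_cylinder_le (C := Real.toNNReal (K * Real.exp C)) fun n x => ?_)
    have h1 : μ.real (cylinder (initWord x n)) ≤ K * Real.exp C
        * (bernoulliMeasure ν).real (cylinder (initWord x n)) := by
      refine (hμ n x).2.trans ?_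
      rw [hcyl, mul_assoc, ← Real.exp_add]
      gcongr
      linarith [(abs_le.1 (h n x)).2]
    rw [← ENNReal.ofReal_toReal (measure_ne_top μ _),
      ← ENNReal.ofReal_toReal (measure_ne_top (bernoulliMeasure ν) _)]
    refine (ENNReal.ofReal_le_ofReal h1).trans_eq ?_
    rw [ENNReal.ofReal_mul (by positivity)]
    rfl
  · rintro rfl
    have hC : 0 ≤ C := (abs_nonneg _).trans (h 0 (fun _ => (nonempty_of_isProbabilityMeasure ν).some))
    refine ⟨inferInstance, measurePreserving_shift_bernoulliMeasure ν, Real.exp C,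
      Real.one_le_exp hC, fun n x => ?_⟩
    have hb := abs_le.1 (h n x)
    rw [hcyl, ← Real.exp_neg, ← Real.exp_add, ← Real.exp_add]
    exact ⟨Real.exp_le_exp.2 (by linarith), Real.exp_le_exp.2 (by linarith)⟩

theorem bernoulliMeasure_injective {ν₁ ν₂ : Measure (Fin d)} [IsProbabilityMeasure ν₁]
    [IsProbabilityMeasure ν₂] (h : bernoulliMeasure ν₁ = bernoulliMeasure ν₂) (i : Fin d) :
    ν₁.real {i} = ν₂.real {i} := by
  have h1 := bernoulliMeasure_real_cylinder ν₁ (fun _ => i) 1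
  have h2 := bernoulliMeasure_real_cylinder ν₂ (fun _ => i) 1
  rw [Finset.prod_range_one] at h1 h2
  rw [← h1, ← h2, h]

end Bernoulli

namespace ConformalIFS

variable {d : ℕ} [Nonempty (Fin d)] {Φ Ψ : ConformalIFS d} {l m : Fin d → ℝ}

theorem sum_exp_sub_P_eq_one (h : Cohomologous Φ.geomPotential (letterPotential l)) (u : ℝ) :
    ∑ i, Real.exp (u * l i - Φ.P u) = 1 := by
  have hpos : 0 < ∑ i, Real.exp (u * l i) :=
    Finset.sum_pos (fun i _ => Real.exp_pos _) Finset.univ_nonempty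
  simp_rw [Real.exp_sub, ← Finset.sum_div, P_eq_log_sum_exp h, Real.exp_log hpos]
  exact div_self hpos.ne'

/-- `μ_{Φ,u}` is the Bernoulli measure with weights `exp (u l_i - P_Φ(u))`. -/
theorem exists_gibbsMeasure_eq_bernoulliMeasure
    (h : Cohomologous Φ.geomPotential (letterPotential l)) (u : ℝ) :
    ∃ ν : Measure (Fin d), IsProbabilityMeasure ν ∧
      (∀ i, ν.real {i} = Real.exp (u * l i - Φ.P u)) ∧
      Φ.gibbsMeasure u = bernoulliMeasure ν := by
  have hsum : ∑ i, ENNReal.ofReal (Real.exp (u * l i - Φ.P u)) = 1 := by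
    rw [← ENNReal.ofReal_sum_of_nonneg fun i _ => (Real.exp_pos _).le, sum_exp_sub_P_eq_one h,
      ENNReal.ofReal_one]
  set ν := (PMF.ofFintype _ hsum).toMeasure with hν
  have hreal : ∀ i, ν.real {i} = Real.exp (u * l i - Φ.P u) := fun i => by
    rw [measureReal_def, hν, PMF.toMeasure_apply_singleton _ _ (measurableSet_singleton i),
      PMF.ofFintype_apply, ENNReal.toReal_ofReal (Real.exp_pos _).le]
  have hcoh : Cohomologous (fun x => u * Φ.geomPotential x - Φ.P u)
      (letterPotential fun i => u * l i - Φ.P u) := by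
    obtain ⟨e, he, hI⟩ := h.const_mul u
    exact ⟨e, he, fun x => by rw [← hI]; simp [letterPotential]⟩
  obtain ⟨C, -, hC⟩ := hcoh.exists_abs_birkhoffSum_sub_le
  have hiff := isInvariantGibbs_iff_eq_bernoulliMeasure ν hreal hC
  refine ⟨ν, inferInstance, hreal, ?_⟩
  have hex : ∃ μ, IsInvariantGibbs (fun x => u * Φ.geomPotential x - Φ.P u) μ :=
    ⟨_, (hiff _).2 rfl⟩
  rw [gibbsMeasure, dif_pos hex]
  exact (hiff _).1 hex.choose_spec

theorem gibbsMeasure_eq_iff (hl : Cohomologous Φ.geomPotential (letterPotential l))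
    (hm : Cohomologous Ψ.geomPotential (letterPotential m)) (u v : ℝ) :
    Φ.gibbsMeasure u = Ψ.gibbsMeasure v ↔ ∀ i, u * l i - Φ.P u = v * m i - Ψ.P v := by
  obtain ⟨ν₁, _, h1, e1⟩ := exists_gibbsMeasure_eq_bernoulliMeasure hl u
  obtain ⟨ν₂, _, h2, e2⟩ := exists_gibbsMeasure_eq_bernoulliMeasure hm v
  rw [e1, e2]
  constructor
  · intro h i
    have := bernoulliMeasure_injective h i
    rw [h1, h2] at this
    exact Real.exp_injective this
  · intro h
    have : ν₁ = ν₂ := by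
      refine Measure.ext_of_singleton fun i => ?_
      have hi : ν₁.real {i} = ν₂.real {i} := by rw [h1, h2, h i]
      exact (ENNReal.toReal_eq_toReal_iff' (measure_ne_top _ _) (measure_ne_top _ _)).1 hi
    rw [this]

end ConformalIFS

/-! ### Comparing first-letter potentials -/

section Comparison

variable {d : ℕ}

/-- Finite families of reals with the same exponential sums agree up to a permutation: by Lagrange
interpolation the power sums of `exp f_i` count how often each value occurs. -/
theorem exists_perm_of_sum_exp_eq {f g : Fin d → ℝ}
    (h : ∀ s : ℝ, ∑ i, Real.exp (s * f i) = ∑ i, Real.exp (s * g i)) :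
    ∃ τ : Equiv.Perm (Fin d), ∀ i, f i = g (τ i) := by
  have hpoly : ∀ p : Polynomial ℝ,
      ∑ i, p.eval (Real.exp (f i)) = ∑ i, p.eval (Real.exp (g i)) := by
    intro p
    simp_rw [Polynomial.eval_eq_sum_range]
    rw [Finset.sum_comm, Finset.sum_comm (s := Finset.univ)]
    refine Finset.sum_congr rfl fun k _ => ?_
    simp_rw [← Finset.mul_sum, ← Real.exp_nat_mul]
    rw [h]
  have hcard : ∀ t : ℝ, Fintype.card {i // f i = t} = Fintype.card {i // g i = t} := by
    intro t
    set S : Finset ℝ := Finset.univ.image f ∪ Finset.univ.image g with hS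
    have hev : ∀ s ∈ S, (Lagrange.interpolate S Real.exp fun s => if s = t then (1 : ℝ) else 0).eval
        (Real.exp s) = if s = t then 1 else 0 := fun s hs =>
      Lagrange.eval_interpolate_at_node _ Real.exp_injective.injOn hs
    have hsum := hpoly (Lagrange.interpolate S Real.exp fun s => if s = t then (1 : ℝ) else 0)
    rw [Finset.sum_congr rfl fun i _ => hev (f i) (by simp [hS]),
      Finset.sum_congr rfl fun i _ => hev (g i) (by simp [hS]), Finset.sum_boole,
      Finset.sum_boole] at hsum
    rw [Fintype.card_subtype, Fintype.card_subtype]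
    exact_mod_cast hsum
  let e : Fin d ≃ Fin d := (Equiv.sigmaFiberEquiv f).symm.trans
    ((Equiv.sigmaCongrRight fun t => Fintype.equivOfCardEq (hcard t)).trans
      (Equiv.sigmaFiberEquiv g))
  exact ⟨e, fun i => ((Fintype.equivOfCardEq (hcard (f i))) ⟨i, rfl⟩).2.symm⟩

theorem Cohomologous.symm {f g : FullShift d → ℝ} (h : Cohomologous f g) : Cohomologous g f := by
  obtain ⟨e, he, h⟩ := h
  exact ⟨fun x => -e x, he.neg, fun x => by linarith [h x]⟩

theorem Cohomologous.trans {f g k : FullShift d → ℝ} (h : Cohomologous f g)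
    (h' : Cohomologous g k) : Cohomologous f k := by
  obtain ⟨e, he, h⟩ := h
  obtain ⟨e', he', h'⟩ := h'
  exact ⟨fun x => e x + e' x, he.add he', fun x => by linarith [h x, h' x]⟩

theorem Cohomologous.add_const {f g : FullShift d → ℝ} (h : Cohomologous f g) (c : ℝ) :
    Cohomologous (fun x => f x + c) (fun x => g x + c) := by
  obtain ⟨e, he, h⟩ := h
  exact ⟨e, he, fun x => by linarith [h x]⟩

/-- First-letter potentials are cohomologous only if they are equal, as one sees at the fixed
points of the shift. -/
theorem cohomologous_letterPotential_iff {l m : Fin d → ℝ} :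
    Cohomologous (letterPotential l) (letterPotential m) ↔ ∀ i, l i = m i := by
  constructor
  · rintro ⟨e, -, h⟩ i
    have hi : l i - m i = e (fun _ => i) - e (fun _ => i) := h fun _ => i
    linarith
  · intro h
    exact ⟨fun _ => 0, continuous_const, fun x => by simp [letterPotential, h]⟩

theorem Cohomologous.tendsto_birkhoffSum_div_iff {f g : FullShift d → ℝ} (h : Cohomologous f g)
    (x : FullShift d) (a : ℝ) :
    Tendsto (fun n : ℕ => birkhoffSum shift f n x / (-(n : ℝ))) atTop (𝓝 a) ↔
      Tendsto (fun n : ℕ => birkhoffSum shift g n x / (-(n : ℝ))) atTop (𝓝 a) := by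
  obtain ⟨C, -, hC⟩ := h.exists_abs_birkhoffSum_sub_le
  refine tendsto_iff_of_dist (squeeze_zero (fun _ => dist_nonneg)
    (g := fun n : ℕ => C * (n : ℝ)⁻¹) (fun n => ?_) ?_)
  · rw [Real.dist_eq, ← sub_div, abs_div, abs_neg, Nat.abs_cast, div_eq_mul_inv]
    gcongr
    exact hC n x
  · simpa using tendsto_inv_atTop_nhds_zero_nat.const_mul C

end Comparison

namespace ConformalIFS

variable {d : ℕ} {Φ Ψ : ConformalIFS d} {l m : Fin d → ℝ}

theorem codingMap_perm (Ψ : ConformalIFS d) (τ : Equiv.Perm (Fin d)) (x : FullShift d) :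
    (Ψ.perm τ).codingMap x = Ψ.codingMap (fun k => τ (x k)) := by
  refine (Ψ.perm τ).codingMap_eq_of_forall_mem fun n => ?_
  have h := Ψ.codingMap_mem_image (fun k => τ (x k)) n
  have e : List.ofFn (initWord (fun k => τ (x k)) n) = (List.ofFn (initWord x n)).map τ := by
    rw [List.map_ofFn]; rfl
  rw [e, ← wordMap_comp] at h
  exact h

theorem geomPotential_perm (Ψ : ConformalIFS d) (τ : Equiv.Perm (Fin d)) (x : FullShift d) :
    (Ψ.perm τ).geomPotential x = Ψ.geomPotential (fun k => τ (x k)) := by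
  rw [geomPotential, codingMap_perm]
  rfl

theorem birkhoffSum_comp_letters (τ : Equiv.Perm (Fin d)) (f : FullShift d → ℝ) (n : ℕ)
    (x : FullShift d) : birkhoffSum shift (fun y => f fun k => τ (y k)) n x
      = birkhoffSum shift f n (fun k => τ (x k)) := by
  refine Finset.sum_congr rfl fun k _ => congrArg f (funext fun q => ?_)
  rw [shift_iterate_apply, shift_iterate_apply]

theorem HasLogRatios.perm (h : Ψ.HasLogRatios m) (τ : Equiv.Perm (Fin d)) :
    (Ψ.perm τ).HasLogRatios fun i => m (τ i) := by
  obtain ⟨hneg, D, hD, hb⟩ := h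
  refine ⟨fun i => hneg _, D, hD, fun n x y hxy => ?_⟩
  obtain ⟨h1, h2⟩ := hb n (fun k => τ (x k)) (fun k => τ (y k)) fun k hk => by rw [hxy k hk]
  rw [codingMap_perm, codingMap_perm]
  rw [birkhoffSum_letterPotential] at *
  exact ⟨h1, fun hn => h2 (τ.injective.ne hn)⟩

theorem cohomologous_perm (h : Cohomologous Ψ.geomPotential (letterPotential m))
    (τ : Equiv.Perm (Fin d)) :
    Cohomologous (Ψ.perm τ).geomPotential (letterPotential fun i => m (τ i)) := by
  obtain ⟨e, he, h⟩ := h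
  refine ⟨fun x => e fun k => τ (x k), he.comp (continuous_pi fun k =>
    continuous_of_discreteTopology.comp (continuous_apply k)), fun x => ?_⟩
  rw [geomPotential_perm]
  exact h _

theorem P_perm [Nonempty (Fin d)] (h : Cohomologous Ψ.geomPotential (letterPotential m))
    (τ : Equiv.Perm (Fin d)) : (Ψ.perm τ).P = Ψ.P := by
  funext s
  rw [P_eq_log_sum_exp (cohomologous_perm h τ), P_eq_log_sum_exp h,
    Equiv.sum_comp τ fun i => Real.exp (s * m i)]

theorem lyapunovSpectrum_perm (Ψ : ConformalIFS d) (τ : Equiv.Perm (Fin d)) (a : ℝ) :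
    (Ψ.perm τ).lyapunovSpectrum a = Ψ.lyapunovSpectrum a := by
  rw [lyapunovSpectrum, lyapunovSpectrum]
  congr 2
  have hpot : (Ψ.perm τ).geomPotential = fun y => Ψ.geomPotential fun k => τ (y k) :=
    funext fun y => geomPotential_perm Ψ τ y
  simp_rw [hpot, birkhoffSum_comp_letters]
  ext p
  constructor
  · rintro ⟨x, hx, rfl⟩
    exact ⟨fun k => τ (x k), hx, (codingMap_perm Ψ τ x).symm⟩
  · rintro ⟨x, hx, rfl⟩
    have e : (fun k => τ (τ.symm (x k))) = x := by simp
    refine ⟨fun k => τ.symm (x k), ?_, ?_⟩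
    · simp only [mem_ofPred_eq, e]
      exact hx
    · rw [codingMap_perm, e]

theorem cohomologous_geomPotential_iff (hl : Cohomologous Φ.geomPotential (letterPotential l))
    (hm : Cohomologous Ψ.geomPotential (letterPotential m)) (a c : ℝ) :
    Cohomologous Φ.geomPotential (fun x => a * Ψ.geomPotential x + c) ↔
      ∀ i, l i = a * m i + c := by
  have h2 : Cohomologous (fun x => a * Ψ.geomPotential x + c)
      (letterPotential fun i => a * m i + c) := (hm.const_mul a).add_const c
  rw [← cohomologous_letterPotential_iff]
  exact ⟨fun h => hl.symm.trans (h.trans h2), fun h => hl.trans (h.trans h2.symm)⟩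

/-- The pressure functions are related as in a rescaling of the parameter exactly when the
logarithmic contraction ratios are related by an affine map, up to a permutation. -/
theorem P_eq_iff_exists_perm [Nonempty (Fin d)]
    (hl : Cohomologous Φ.geomPotential (letterPotential l))
    (hm : Cohomologous Ψ.geomPotential (letterPotential m)) (a c : ℝ) :
    (∀ s, Φ.P s = Ψ.P (s * a) + s * c) ↔
      ∃ τ : Equiv.Perm (Fin d), ∀ i, l i = a * m (τ i) + c := by
  have hpos : ∀ f : Fin d → ℝ, 0 < ∑ i, Real.exp (f i) := fun f =>
    Finset.sum_pos (fun i _ => Real.exp_pos _) Finset.univ_nonempty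
  have hΨ : ∀ s, Ψ.P (s * a) + s * c = Real.log (∑ i, Real.exp (s * (a * m i + c))) := by
    intro s
    have e : ∀ i, Real.exp (s * (a * m i + c)) = Real.exp (s * a * m i) * Real.exp (s * c) :=
      fun i => by
        rw [← Real.exp_add]
        ring_nf
    simp_rw [e]
    rw [P_eq_log_sum_exp hm, ← Finset.sum_mul, Real.log_mul (hpos _).ne' (Real.exp_pos _).ne',
      Real.log_exp]
  simp_rw [hΨ, P_eq_log_sum_exp hl]
  constructor
  · intro h
    exact exists_perm_of_sum_exp_eq fun s => Real.log_injOn_pos (hpos _) (hpos _) (h s)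
  · rintro ⟨τ, hτ⟩ s
    simp_rw [hτ]
    rw [Equiv.sum_comp τ fun i => Real.exp (s * (a * m i + c))]

theorem hasDerivAt_P [Nonempty (Fin d)] (h : Cohomologous Φ.geomPotential (letterPotential l))
    (u : ℝ) : HasDerivAt Φ.P
      ((∑ i, l i * Real.exp (u * l i)) / ∑ i, Real.exp (u * l i)) u := by
  have hP : Φ.P = fun u => Real.log (∑ i, Real.exp (u * l i)) := funext (P_eq_log_sum_exp h)
  rw [hP]
  have hpos : 0 < ∑ i, Real.exp (u * l i) :=
    Finset.sum_pos (fun i _ => Real.exp_pos _) Finset.univ_nonempty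
  refine (HasDerivAt.fun_sum fun i _ => ?_).log hpos.ne'
  have := ((hasDerivAt_id u).mul_const (l i)).exp
  simpa [mul_comm] using this

theorem α_pos [Nonempty (Fin d)] (hl : Φ.HasLogRatios l)
    (h : Cohomologous Φ.geomPotential (letterPotential l)) (u : ℝ) : 0 < Φ.α u := by
  rw [α, (hasDerivAt_P h u).deriv, neg_pos]
  exact div_neg_of_neg_of_pos
    (Finset.sum_neg (fun i _ => mul_neg_of_neg_of_pos (hl.neg i) (Real.exp_pos _))
      Finset.univ_nonempty)
    (Finset.sum_pos (fun i _ => Real.exp_pos _) Finset.univ_nonempty)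

end ConformalIFS

/-! ### Comparing the dimensions of level sets -/

namespace ConformalIFS

variable {d : ℕ} {Φ Ψ : ConformalIFS d} {l m : Fin d → ℝ}

theorem exists_first_ne {x y : FullShift d} (h : x ≠ y) : ∃ n, (∀ k < n, x k = y k) ∧ x n ≠ y n := by
  classical
  have hex : ∃ n, x n ≠ y n := Function.ne_iff.1 h
  exact ⟨Nat.find hex, fun k hk => not_not.1 (Nat.find_min hex hk), Nat.find_spec hex⟩

theorem HasLogRatios.injective_codingMap (h : Φ.HasLogRatios l) :
    Function.Injective Φ.codingMap := by
  obtain ⟨-, D, hD, hb⟩ := h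
  intro x y hxy
  by_contra hne
  obtain ⟨n, hn, hn'⟩ := exists_first_ne hne
  have := (hb n x y hn).2 hn'
  rw [hxy, sub_self, abs_zero, mul_zero] at this
  exact this.not_gt (Real.exp_pos _)

theorem holderOnWith_of_abs_sub_le {f : ℝ → ℝ} {s : Set ℝ} {C r : ℝ≥0}
    (h : ∀ x ∈ s, ∀ y ∈ s, |f x - f y| ≤ C * |x - y| ^ (r : ℝ)) : HolderOnWith C r f s := by
  intro x hx y hy
  rw [edist_dist, edist_dist, ENNReal.ofReal_rpow_of_nonneg dist_nonneg r.coe_nonneg,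
    ← ENNReal.ofReal_coe_nnreal, ← ENNReal.ofReal_mul C.coe_nonneg]
  exact ENNReal.ofReal_le_ofReal (h x hx y hy)

theorem exists_nat_forall_le_of_eventually_nonpos {s : ℕ → ℝ} (h : ∀ᶠ n in atTop, s n ≤ 0) :
    ∃ K : ℕ, ∀ n, s n ≤ K := by
  obtain ⟨N, hN⟩ := eventually_atTop.1 h
  obtain ⟨K, hK⟩ := exists_nat_ge (∑ n ∈ Finset.range N, |s n|)
  refine ⟨K, fun n => ?_⟩
  rcases lt_or_ge n N with hn | hn
  · exact (le_abs_self _).trans ((Finset.single_le_sum (f := fun n => |s n|)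
      (fun _ _ => abs_nonneg _) (Finset.mem_range.2 hn)).trans hK)
  · exact (hN n hn).trans K.cast_nonneg

/-- If the cylinders around each code in `E` shrink at the exponential rates `a` in `Φ` and `b` in
`Ψ`, then the conjugacy between the limit sets is, on countably many pieces covering the part
coded by `E`, Hölder with any exponent below `b / a`. -/
theorem mul_dimH_image_codingMap_le (hΦ : Φ.HasLogRatios l) (hΨ : Ψ.HasLogRatios m)
    {E : Set (FullShift d)} {a b : ℝ} (ha : 0 < a) (hb : 0 < b)
    (hEl : ∀ x ∈ E, Tendsto
      (fun n : ℕ => birkhoffSum shift (letterPotential l) n x / (-(n : ℝ))) atTop (𝓝 a))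
    (hEm : ∀ x ∈ E, Tendsto
      (fun n : ℕ => birkhoffSum shift (letterPotential m) n x / (-(n : ℝ))) atTop (𝓝 b)) :
    b * (dimH (Ψ.codingMap '' E)).toReal ≤ a * (dimH (Φ.codingMap '' E)).toReal := by
  have hfin : ∀ s : Set ℝ, dimH s ≠ ⊤ := fun s =>
    ne_top_of_le_ne_top (by simp) ((dimH_mono (subset_univ s)).trans_eq Real.dimH_univ)
  have key : ∀ ε, 0 < ε → ε < b → (b - ε) * (dimH (Ψ.codingMap '' E)).toReal
      ≤ (a + ε) * (dimH (Φ.codingMap '' E)).toReal := by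
    intro ε hε hεb
    have hinj := hΦ.injective_codingMap
    obtain ⟨-, D, hD, hdist⟩ := hΦ
    obtain ⟨-, D', hD', hdist'⟩ := hΨ
    have hae : 0 < a + ε := by linarith
    have hbe : 0 < b - ε := by linarith
    set r : ℝ≥0 := ⟨(b - ε) / (a + ε), by positivity⟩ with hr
    have hr0 : 0 < r := NNReal.coe_pos.1 (show (0 : ℝ) < (b - ε) / (a + ε) by positivity)
    have hrmul : (a + ε) * (r : ℝ) = b - ε := by
      change (a + ε) * ((b - ε) / (a + ε)) = b - ε
      field_simp
    -- On `F K` the lengths of all cylinders obey the two rates up to the factor `exp K`.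
    set F : ℕ → Set (FullShift d) := fun K => {x | x ∈ E ∧ ∀ n : ℕ,
      -(n * (a + ε)) - birkhoffSum shift (letterPotential l) n x ≤ K ∧
      birkhoffSum shift (letterPotential m) n x + n * (b - ε) ≤ K} with hF
    have hcover : E = ⋃ K, F K := by
      ext x
      refine ⟨fun hx => ?_, fun hx => (mem_iUnion.1 hx).choose_spec.1⟩
      have e1 : ∀ᶠ n : ℕ in atTop,
          -(n * (a + ε)) - birkhoffSum shift (letterPotential l) n x ≤ 0 := by
        filter_upwards [(hEl x hx).eventually_lt_const (show a < a + ε by linarith),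
          eventually_gt_atTop 0] with n hn hn0
        have hn0' : (0 : ℝ) < n := by exact_mod_cast hn0
        rw [div_neg, neg_lt, lt_div_iff₀ hn0'] at hn
        linarith
      have e2 : ∀ᶠ n : ℕ in atTop,
          birkhoffSum shift (letterPotential m) n x + n * (b - ε) ≤ 0 := by
        filter_upwards [(hEm x hx).eventually_const_lt (show b - ε < b by linarith),
          eventually_gt_atTop 0] with n hn hn0
        have hn0' : (0 : ℝ) < n := by exact_mod_cast hn0
        rw [div_neg, lt_neg, div_lt_iff₀ hn0'] at hn
        linarith
      obtain ⟨K₁, h1⟩ := exists_nat_forall_le_of_eventually_nonpos e1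
      obtain ⟨K₂, h2⟩ := exists_nat_forall_le_of_eventually_nonpos e2
      refine mem_iUnion.2 ⟨max K₁ K₂, hx, fun n => ⟨(h1 n).trans ?_, (h2 n).trans ?_⟩⟩
      · exact_mod_cast le_max_left _ _
      · exact_mod_cast le_max_right _ _
    set f : ℝ → ℝ := Function.extend Φ.codingMap Ψ.codingMap 0 with hf
    have hfcode : ∀ x, f (Φ.codingMap x) = Ψ.codingMap x := hinj.extend_apply _ _
    have hholder : ∀ K, ∃ C : ℝ≥0, HolderOnWith C r f (Φ.codingMap '' F K) := by
      intro K
      set C : ℝ≥0 := ⟨D' * Real.exp K * (Real.exp K * D) ^ (r : ℝ), by positivity⟩ with hC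
      refine ⟨C, holderOnWith_of_abs_sub_le ?_⟩
      rintro _ ⟨x, hx, rfl⟩ _ ⟨y, hy, rfl⟩
      rw [hfcode, hfcode]
      rcases eq_or_ne x y with rfl | hne
      · rw [sub_self, abs_zero]
        positivity
      obtain ⟨n, hn, hn'⟩ := exists_first_ne hne
      have u1 := (hdist n x y hn).2 hn'
      have u2 := (hdist' n x y hn).1
      obtain ⟨v1, v2⟩ := hx.2 n
      have w1 : Real.exp (-(n * (a + ε)))
          ≤ Real.exp K * D * |Φ.codingMap x - Φ.codingMap y| := by
        rw [mul_assoc]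
        refine le_trans ?_ (mul_le_mul_of_nonneg_left u1 (Real.exp_pos _).le)
        rw [← Real.exp_add]
        exact Real.exp_le_exp.2 (by linarith)
      have w2 : |Ψ.codingMap x - Ψ.codingMap y|
          ≤ D' * Real.exp K * Real.exp (-(n * (a + ε))) ^ (r : ℝ) := by
        refine u2.trans ?_
        rw [mul_assoc, ← Real.exp_mul, ← Real.exp_add, neg_mul, mul_assoc, hrmul]
        gcongr
        linarith
      refine w2.trans ?_
      change _ ≤ D' * Real.exp K * (Real.exp K * D) ^ (r : ℝ) * _
      rw [mul_assoc (D' * Real.exp K), ← Real.mul_rpow (by positivity) (abs_nonneg _)]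
      gcongr
    have hdim : dimH (Ψ.codingMap '' E) ≤ dimH (Φ.codingMap '' E) / r := by
      have himg : Ψ.codingMap '' E = ⋃ K, f '' (Φ.codingMap '' F K) := by
        conv_lhs => rw [hcover]
        rw [image_iUnion]
        refine iUnion_congr fun K => ?_
        rw [image_image]
        exact image_congr fun x _ => (hfcode x).symm
      rw [himg, dimH_iUnion]
      refine iSup_le fun K => ?_
      obtain ⟨C, hC⟩ := hholder K
      refine (hC.dimH_image_le hr0).trans (ENNReal.div_le_div_right (dimH_mono ?_) _)
      exact image_mono fun x hx => hx.1
    have hreal := ENNReal.toReal_mono (ENNReal.div_ne_top (hfin _) (by simpa using hr0.ne')) hdim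
    rw [ENNReal.toReal_div, ENNReal.coe_toReal, le_div_iff₀ (NNReal.coe_pos.2 hr0)] at hreal
    rw [← hrmul]
    calc (a + ε) * (r : ℝ) * (dimH (Ψ.codingMap '' E)).toReal
        = (a + ε) * ((dimH (Ψ.codingMap '' E)).toReal * r) := by ring
      _ ≤ _ := by gcongr
  have hlim : ∀ A B : ℝ, Tendsto (fun ε : ℝ => (A + B * ε)) (𝓝[>] 0) (𝓝 A) := fun A B => by
    have : Continuous fun ε : ℝ => A + B * ε := by fun_prop
    simpa using (this.tendsto 0).mono_left nhdsWithin_le_nhds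
  refine le_of_tendsto_of_tendsto (hlim _ (-(dimH (Ψ.codingMap '' E)).toReal))
    (hlim _ (dimH (Φ.codingMap '' E)).toReal) ?_
  filter_upwards [Ioo_mem_nhdsGT hb] with ε hε
  have := key ε hε.1 hε.2
  linarith

theorem mul_dimH_image_codingMap_eq (hΦ : Φ.HasLogRatios l) (hΨ : Ψ.HasLogRatios m)
    {E : Set (FullShift d)} {a b : ℝ} (ha : 0 < a) (hb : 0 < b)
    (hEl : ∀ x ∈ E, Tendsto
      (fun n : ℕ => birkhoffSum shift (letterPotential l) n x / (-(n : ℝ))) atTop (𝓝 a))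
    (hEm : ∀ x ∈ E, Tendsto
      (fun n : ℕ => birkhoffSum shift (letterPotential m) n x / (-(n : ℝ))) atTop (𝓝 b)) :
    a * (dimH (Φ.codingMap '' E)).toReal = b * (dimH (Ψ.codingMap '' E)).toReal :=
  le_antisymm (mul_dimH_image_codingMap_le hΨ hΦ hb ha hEm hEl)
    (mul_dimH_image_codingMap_le hΦ hΨ ha hb hEl hEm)

/-- When the logarithmic contraction ratios of `Φ` are an affine function of those of `Ψ`, the level
sets of the two Lyapunov spectra at `α_Φ(u)` and `α_Ψ(v)` have the same codes. -/
theorem α_mul_lyapunovSpectrum_eq [Nonempty (Fin d)] (hΦ : Φ.HasLogRatios l)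
    (hl : Cohomologous Φ.geomPotential (letterPotential l)) (hΨ : Ψ.HasLogRatios m)
    (hm : Cohomologous Ψ.geomPotential (letterPotential m)) {u v c : ℝ} (hu : u ≠ 0) (hv : v ≠ 0)
    (h : ∀ i, l i = v / u * m i + c) :
    Φ.α u * Φ.lyapunovSpectrum (Φ.α u) = Ψ.α v * Ψ.lyapunovSpectrum (Ψ.α v) := by
  set a := v / u with ha
  have ha0 : a ≠ 0 := div_ne_zero hv hu
  have hPP : Φ.P = fun s => Ψ.P (s * a) + s * c :=
    funext ((P_eq_iff_exists_perm hl hm a c).2 ⟨Equiv.refl _, h⟩)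
  have hα : Φ.α u = a * Ψ.α v - c := by
    have huv : u * a = v := by rw [ha]; field_simp
    have hd : HasDerivAt Ψ.P (deriv Ψ.P v) (u * a) := by
      rw [huv]
      exact (hasDerivAt_P hm v).differentiableAt.hasDerivAt
    have hd₁ : HasDerivAt (fun s => Ψ.P (s * a)) (deriv Ψ.P v * (1 * a)) u :=
      HasDerivAt.comp (h₂ := Ψ.P) (h := fun s => s * a) u hd ((hasDerivAt_id' u).mul_const a)
    have hd' : HasDerivAt (fun s => Ψ.P (s * a) + s * c) (deriv Ψ.P v * (1 * a) + 1 * c) u :=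
      hd₁.fun_add ((hasDerivAt_id' u).mul_const c)
    rw [α, α, hPP, hd'.deriv]
    ring
  have hsum : ∀ n x, birkhoffSum shift (letterPotential l) n x
      = a * birkhoffSum shift (letterPotential m) n x + n * c := fun n x => by
    rw [birkhoffSum_letterPotential, birkhoffSum_letterPotential,
      Finset.sum_congr rfl fun k _ => h (x k), Finset.sum_add_distrib, ← Finset.mul_sum]
    simp
  have hlevel : ∀ x, Tendsto
      (fun n : ℕ => birkhoffSum shift (letterPotential l) n x / (-(n : ℝ))) atTop (𝓝 (Φ.α u)) ↔
      Tendsto (fun n : ℕ => birkhoffSum shift (letterPotential m) n x / (-(n : ℝ))) atTop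
        (𝓝 (Ψ.α v)) := by
    intro x
    have hev : (fun n : ℕ => birkhoffSum shift (letterPotential l) n x / (-(n : ℝ))) =ᶠ[atTop]
        fun n : ℕ => a * (birkhoffSum shift (letterPotential m) n x / (-(n : ℝ))) - c := by
      filter_upwards [eventually_gt_atTop 0] with n hn
      have hn' : (n : ℝ) ≠ 0 := by exact_mod_cast hn.ne'
      rw [hsum]
      field_simp
      ring
    rw [tendsto_congr' hev, hα]
    constructor
    · intro ht
      have := (ht.add_const c).const_mul a⁻¹
      simpa [ha0] using this
    · intro ht
      exact (ht.const_mul a).sub_const c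
  rw [lyapunovSpectrum, lyapunovSpectrum]
  simp_rw [hl.tendsto_birkhoffSum_div_iff, hm.tendsto_birkhoffSum_div_iff, hlevel]
  exact mul_dimH_image_codingMap_eq hΦ hΨ (α_pos hΦ hl u) (α_pos hΨ hm v)
    (fun x hx => (hlevel x).2 hx) fun x hx => hx

end ConformalIFS

end ConfIFS

end

theorem mainTheorem4 {d : ℕ} (hd : 2 ≤ d) (Φ Ψ : ConfIFS.ConformalIFS d)
    (hΦ : Φ.IsEssentiallyAffine) (hΨ : Ψ.IsEssentiallyAffine)
    (u v : ℝ) (hu : u ≠ 0) (hv : v ≠ 0) :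
    List.TFAE [
      ConfIFS.ConformalIFS.GibbsEqUpToPerm Φ u Ψ v,
      ConfIFS.ConformalIFS.CohomEqUpToPerm Φ Ψ (v / u) ((Φ.P u - Ψ.P v) / u),
      ∀ s : ℝ, Φ.P s = Ψ.P (s * (v / u)) + s * ((Φ.P u - Ψ.P v) / u)] ∧
    ((ConfIFS.ConformalIFS.GibbsEqUpToPerm Φ u Ψ v ∨
      ConfIFS.ConformalIFS.CohomEqUpToPerm Φ Ψ (v / u) ((Φ.P u - Ψ.P v) / u) ∨
      ∀ s : ℝ, Φ.P s = Ψ.P (s * (v / u)) + s * ((Φ.P u - Ψ.P v) / u)) →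
      Φ.α u * Φ.lyapunovSpectrum (Φ.α u) = Ψ.α v * Ψ.lyapunovSpectrum (Ψ.α v)) := by
  have : Nontrivial (Fin d) := Fin.nontrivial_iff_two_le.2 hd
  obtain ⟨l, hl, hcl⟩ := hΦ.exists_hasLogRatios
  obtain ⟨m, hm, hcm⟩ := hΨ.exists_hasLogRatios
  -- Each of the three statements says that the ratios are related by this affine map.
  set R : Prop := ∃ τ : Equiv.Perm (Fin d), ∀ i,
    l i = v / u * m (τ i) + (Φ.P u - Ψ.P v) / u with hR
  have h1 : ConfIFS.ConformalIFS.GibbsEqUpToPerm Φ u Ψ v ↔ R := by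
    refine exists_congr fun τ => ?_
    rw [ConfIFS.ConformalIFS.gibbsMeasure_eq_iff hcl
      (ConfIFS.ConformalIFS.cohomologous_perm hcm τ), ConfIFS.ConformalIFS.P_perm hcm]
    refine forall_congr' fun i => ?_
    rw [div_mul_eq_mul_div, ← add_div, eq_div_iff hu]
    constructor <;> intro h <;> linarith
  have h2 : ConfIFS.ConformalIFS.CohomEqUpToPerm Φ Ψ (v / u) ((Φ.P u - Ψ.P v) / u) ↔ R :=
    exists_congr fun τ => ConfIFS.ConformalIFS.cohomologous_geomPotential_iff hcl
      (ConfIFS.ConformalIFS.cohomologous_perm hcm τ) _ _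
  have h3 := ConfIFS.ConformalIFS.P_eq_iff_exists_perm hcl hcm (v / u) ((Φ.P u - Ψ.P v) / u)
  refine ⟨?_, ?_⟩
  · tfae_have 1 ↔ 2 := h1.trans h2.symm
    tfae_have 2 ↔ 3 := h2.trans h3.symm
    tfae_finish
  · rw [h1, h2, h3]
    intro h
    obtain ⟨τ, hτ⟩ : R := by tauto
    have key := ConfIFS.ConformalIFS.α_mul_lyapunovSpectrum_eq hl hcl (hm.perm τ)
      (ConfIFS.ConformalIFS.cohomologous_perm hcm τ) hu hv hτ
    have hα : (Ψ.perm τ).α = Ψ.α := by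
      funext s
      rw [ConfIFS.ConformalIFS.α, ConfIFS.ConformalIFS.α, ConfIFS.ConformalIFS.P_perm hcm]
    rwa [hα, ConfIFS.ConformalIFS.lyapunovSpectrum_perm] at key
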